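/- Let $(Z_k)_{k\ge 1}$ be a sequence of independent and identically distributed complex random variables, defined on a probability space $(\Omega,\mathcal F,\mathbb P)$, whose common law $\mu$ is an arbitrary Borel probability measure on $\mathbb C$. For $n\ge 2$ let $$P_n(X)=\prod_{k=1}^n (X-Z_k),$$ let $W_1,\dots,W_{n-1}$ be the critical points of $P_n$, i.e. the complex zeros of $P_n'$ listed with multiplicity, and let $$\nu_n=\frac1{n-1}\sum_{i=1}^{n-1}\delta_{W_i}$$ be their (random) empirical measure. Then, $\mathbb P$-almost surely, the sequence of probability measures $(\nu_n)_{n\ge 2}$ converges weakly (in distribution) to $\mu$ as $n\to\infty$. -/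

import Mathlib

open MeasureTheory ProbabilityTheory Filter Topology Polynomial
open scoped ENNReal

/-- The monic polynomial of degree `n` with roots `z 0, …, z (n - 1)` (repeated according to
multiplicity). -/
noncomputable def rootPoly (z : ℕ → ℂ) (n : ℕ) : ℂ[X] :=
  ∏ k ∈ Finset.range n, (X - C (z k))

/-- The critical points of `rootPoly z n`: the complex zeros of its derivative, listed with
multiplicity. -/
noncomputable def criticalPoints (z : ℕ → ℂ) (n : ℕ) : Multiset ℂ :=
  (derivative (rootPoly z n)).roots

/-- The empirical measure `(1 / (n - 1)) ∑ δ_w`, with `w` running over the critical points of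
`rootPoly z n` counted with multiplicity. It is meaningful for `n ≥ 2`. -/
noncomputable def criticalMeasure (z : ℕ → ℂ) (n : ℕ) : Measure ℂ :=
  ((n - 1 : ℕ) : ℝ≥0∞)⁻¹ • ((criticalPoints z n).map Measure.dirac).sum

theorem card_criticalPoints (z : ℕ → ℂ) (n : ℕ) :
    (criticalPoints z n).card = n - 1 := by
  have h1 : (rootPoly z n).natDegree = n := by
    simp [rootPoly, natDegree_prod_of_monic _ _ (fun k _ => monic_X_sub_C (z k))]
  rw [criticalPoints, ← (IsAlgClosed.splits _).natDegree_eq_card_roots,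
    natDegree_derivative, h1]

theorem sum_dirac_univ (s : Multiset ℂ) :
    (s.map Measure.dirac).sum Set.univ = (s.card : ℝ≥0∞) := by
  induction s using Multiset.induction_on with
  | empty => simp
  | cons a s ih => simp [ih, add_comm]

theorem isProbabilityMeasure_criticalMeasure (z : ℕ → ℂ) {n : ℕ} (hn : 2 ≤ n) :
    IsProbabilityMeasure (criticalMeasure z n) := by
  constructor
  rw [criticalMeasure, Measure.smul_apply, sum_dirac_univ, card_criticalPoints, smul_eq_mul]
  refine ENNReal.inv_mul_cancel ?_ (ENNReal.natCast_ne_top _)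
  have : n - 1 ≠ 0 := by omega
  exact_mod_cast this

/-- The empirical measure of the critical points, for `n ≥ 2`, as a point of the space of Borel
probability measures on `ℂ` with the topology of weak convergence. -/
noncomputable def criticalProbabilityMeasure (z : ℕ → ℂ) (n : ℕ) (hn : 2 ≤ n) :
    ProbabilityMeasure ℂ :=
  ⟨criticalMeasure z n, isProbabilityMeasure_criticalMeasure z hn⟩

/-!
Write `P = rootPoly z n` and `S = P' / P = ∑ 1 / (x - z k)`. Since `log |P'|` and `log |P|` are,
up to an additive constant, the logarithmic potentials of the critical points and of the roots,
the two empirical measures are asymptotically equal as soon as `log |S| / n` tends to zero in `L¹`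
of every disc: every continuous compactly supported function is a uniform limit of logarithmic
potentials of continuous compactly supported densities (`exists_log_potential_approx`, by averaging
the logarithm over circles), which gives `tendsto_sum_criticalPoints_sub_sum_roots`.

The `L¹` convergence holds for any sequence `z` for which the set `smallSet z n`, where `|S| ≤ 1`,
becomes negligible in every disc (`tendsto_integral_abs_log_norm_cauchySum`). Off that set
`0 ≤ log |S| ≤ η |S| + log (1 / η)`, and the integral of `|S|` over a disc is `O(n)`. On that set,
`log |S|` is a constant plus potentials with kernel `log |x - w| - log⁺ |w|`, which are `O(n)` and
uniformly integrable whatever the roots are; the constant is `O(n)` by comparison with the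
complement. In particular no moment assumption on the roots is needed.

It remains to see that `smallSet` is almost surely negligible in the limit. By Fubini and dominated
convergence applied to its cube, it is enough that for almost every triple `(x 0, x 1, x 2)`, almost
surely, the three points do not lie in the set simultaneously for infinitely many `n`. If `μ` has
infinite support, the vector of Cauchy kernels `1 / (x j - Z)` lies in no complex affine hyperplane
of `ℂ³`, so that its characteristic function `φ` satisfies `|φ(t) φ(-it)| ≤ exp (-b |t|²)` near the
origin, and an Esseen type inequality bounds the probability that the sums at the three points are
all at most `1` in modulus by a multiple of `n ^ (-3 / 2)`
(`exists_measureReal_smallSet_sq_le`); three points are needed to make this summable for the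
Borel–Cantelli lemma. If `μ` has finite support, the strong law of large numbers gives
`S(x) / n → ∫ 1 / (x - w) dμ(w)`, which is nonzero outside a finite set.

Finally the empirical measures of the roots converge to `μ` by the strong law of large numbers
(`ae_tendsto_average_of_hasCompactSupport`).
-/

/-! ### The logarithmic kernel in the plane -/

instance isFiniteMeasure_restrict_closedBall (R : ℝ) :
    IsFiniteMeasure (volume.restrict (Metric.closedBall (0 : ℂ) R)) :=
  isFiniteMeasure_restrict.2 (measure_closedBall_lt_top).ne

open Real in
theorem integrableOn_inv_norm_closedBall_one :
    IntegrableOn (fun z : ℂ => ‖z‖⁻¹) (Metric.closedBall 0 1) := by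
  refine ⟨(measurable_norm.inv).aestronglyMeasurable, ?_⟩
  rw [HasFiniteIntegral, ← lintegral_indicator Metric.isClosed_closedBall.measurableSet,
    ← Complex.lintegral_comp_polarCoord_symm]
  calc _ ≤ ∫⁻ p in polarCoord.target, (Set.Icc (0 : ℝ) 1 ×ˢ Set.Icc (-π) π).indicator 1 p := by
        refine setLIntegral_mono' polarCoord.open_target.measurableSet fun p hp => ?_
        have h1 : 0 < p.1 := by simpa [polarCoord] using hp.1
        have h2 : p.2 ∈ Set.Ioo (-π) π := by simpa [polarCoord] using hp.2
        by_cases h : Complex.polarCoord.symm p ∈ Metric.closedBall (0 : ℂ) 1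
        · have hn : ‖Complex.polarCoord.symm p‖ = p.1 := by
            rw [Complex.norm_polarCoord_symm, abs_of_pos h1]
          have h3 : p.1 ≤ 1 := by rwa [mem_closedBall_zero_iff, hn] at h
          have hp' : p ∈ Set.Icc (0 : ℝ) 1 ×ˢ Set.Icc (-π) π :=
            ⟨⟨h1.le, h3⟩, ⟨h2.1.le, h2.2.le⟩⟩
          rw [Set.indicator_of_mem h, Set.indicator_of_mem hp', hn, smul_eq_mul,
            Real.enorm_eq_ofReal (by positivity), ← ENNReal.ofReal_mul h1.le,
            mul_inv_cancel₀ h1.ne']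
          simp
        · rw [Set.indicator_of_notMem h]; simp
    _ ≤ ∫⁻ p : ℝ × ℝ, (Set.Icc (0 : ℝ) 1 ×ˢ Set.Icc (-π) π).indicator 1 p :=
        setLIntegral_le_lintegral _ _
    _ = volume (Set.Icc (0 : ℝ) 1 ×ˢ Set.Icc (-π) π) := by
        rw [lintegral_indicator_one (measurableSet_Icc.prod measurableSet_Icc)]
    _ < ⊤ := by
        rw [Measure.volume_eq_prod, Measure.prod_prod]
        exact ENNReal.mul_lt_top (by simp) (by simp)

theorem inv_norm_sub_le_indicator_add_one (z w : ℂ) :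
    ‖z - w‖⁻¹ ≤ (Metric.closedBall (0 : ℂ) 1).indicator (fun z => ‖z‖⁻¹) (z - w) + 1 := by
  by_cases h : z - w ∈ Metric.closedBall (0 : ℂ) 1
  · rw [Set.indicator_of_mem h]; linarith
  · rw [Set.indicator_of_notMem h, zero_add]
    rw [mem_closedBall_zero_iff, not_le] at h
    exact inv_le_one_of_one_le₀ h.le

theorem integrable_indicator_inv_norm :
    Integrable ((Metric.closedBall (0 : ℂ) 1).indicator (fun z => ‖z‖⁻¹)) :=
  (integrable_indicator_iff Metric.isClosed_closedBall.measurableSet).2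
    integrableOn_inv_norm_closedBall_one

theorem integrableOn_inv_norm_sub (R : ℝ) (w : ℂ) :
    IntegrableOn (fun z : ℂ => ‖z - w‖⁻¹) (Metric.closedBall 0 R) := by
  refine (((integrable_indicator_inv_norm.comp_sub_right w).integrableOn
    (s := Metric.closedBall 0 R)).add (integrable_const 1)).mono'
    (by fun_prop) (.of_forall fun z => ?_)
  rw [Real.norm_of_nonneg (by positivity)]
  exact inv_norm_sub_le_indicator_add_one z w

/-- The potential of the kernel `1 / |z|` over a disc is bounded uniformly in the pole. -/
theorem exists_setIntegral_inv_norm_sub_le (R : ℝ) :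
    ∃ C : ℝ, 0 ≤ C ∧ ∀ w : ℂ, ∫ z in Metric.closedBall 0 R, ‖z - w‖⁻¹ ≤ C := by
  set f := (Metric.closedBall (0 : ℂ) 1).indicator (fun z => ‖z‖⁻¹) with hf
  have f0 : ∀ z, 0 ≤ f z := fun z => Set.indicator_nonneg (fun _ _ => by positivity) z
  refine ⟨(∫ z, f z) + ∫ z in Metric.closedBall (0 : ℂ) R, (1 : ℝ),
    add_nonneg (integral_nonneg f0) (integral_nonneg fun _ => zero_le_one), fun w => ?_⟩
  have hi : Integrable (fun z => f (z - w)) := integrable_indicator_inv_norm.comp_sub_right w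
  calc _ ≤ ∫ z in Metric.closedBall (0 : ℂ) R, (f (z - w) + 1) :=
        integral_mono (integrableOn_inv_norm_sub R w) (hi.integrableOn.add (integrable_const 1))
          fun z => inv_norm_sub_le_indicator_add_one z w
    _ = (∫ z in Metric.closedBall (0 : ℂ) R, f (z - w)) +
          ∫ z in Metric.closedBall (0 : ℂ) R, (1 : ℝ) :=
        integral_add hi.integrableOn (integrable_const 1)
    _ ≤ _ := by
        gcongr
        rw [← integral_sub_right_eq_self f w]
        exact setIntegral_le_integral hi (.of_forall fun z => f0 _)

theorem log_le_mul_add_log_inv {η x : ℝ} (hη : 0 < η) (hx : 0 < x) :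
    Real.log x ≤ η * x + Real.log η⁻¹ := by
  have := Real.log_le_sub_one_of_pos (mul_pos hη hx)
  rw [Real.log_mul hη.ne' hx.ne'] at this
  rw [Real.log_inv]; linarith

/-- Subtracting `log⁺ |w|` normalises the logarithmic kernel so that on a disc it is controlled
uniformly in the position of the pole `w`, however far away. The free parameter `η` turns this
bound into uniform integrability. -/
theorem abs_log_norm_sub_sub_posLog_le {R η : ℝ} (hR : 1 ≤ R) (hη : 0 < η) (hη1 : η ≤ 1)
    {z : ℂ} (hz : z ∈ Metric.closedBall (0 : ℂ) R) (w : ℂ) :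
    |Real.log ‖z - w‖ - Real.posLog ‖w‖| ≤
      Real.log (4 * R) + Real.log η⁻¹ + η * ‖z - w‖⁻¹ := by
  rw [mem_closedBall_zero_iff] at hz
  have hlog : 0 ≤ Real.log η⁻¹ := Real.log_nonneg ((one_le_inv₀ hη).2 hη1)
  have hp : Real.posLog ‖w‖ = Real.log (max 1 ‖w‖) := Real.posLog_eq_log_max_one (norm_nonneg _)
  have h2R : Real.log (4 * R) = Real.log 2 + Real.log (2 * R) := by
    rw [← Real.log_mul (by norm_num) (by positivity)]; ring_nf
  have l2 : 0 ≤ Real.log 2 := Real.log_nonneg (by norm_num)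
  have l2R : 0 ≤ Real.log (2 * R) := Real.log_nonneg (by linarith)
  rcases eq_or_ne z w with rfl | hzw
  · have : Real.log (max 1 ‖z‖) ≤ Real.log (2 * R) :=
      Real.log_le_log (by positivity) (max_le (by linarith) (by linarith))
    have h0 : 0 ≤ Real.log (max 1 ‖z‖) := Real.log_nonneg (le_max_left _ _)
    simp only [sub_self, norm_zero, Real.log_zero, zero_sub, abs_neg, inv_zero, mul_zero, hp,
      abs_of_nonneg h0]
    linarith
  have hpos : 0 < ‖z - w‖ := norm_pos_iff.2 (sub_ne_zero.2 hzw)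
  have hinv : 0 ≤ η * ‖z - w‖⁻¹ := by positivity
  have hm : (0 : ℝ) < max 1 ‖w‖ := by positivity
  rw [abs_le]
  constructor
  · by_cases hw : 2 * R ≤ ‖w‖
    · have h1 : ‖w‖ ≤ 2 * ‖z - w‖ := by
        have := norm_sub_norm_le w z
        rw [norm_sub_rev] at this
        linarith
      have h2 : Real.log (max 1 ‖w‖) ≤ Real.log 2 + Real.log ‖z - w‖ := by
        rw [← Real.log_mul (by norm_num) hpos.ne']
        exact Real.log_le_log hm (max_le (by linarith) h1)
      rw [hp]; linarith
    · have h1 : Real.log (max 1 ‖w‖) ≤ Real.log (2 * R) :=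
        Real.log_le_log hm (max_le (by linarith) (by linarith))
      have h2 := log_le_mul_add_log_inv hη (inv_pos.2 hpos)
      rw [Real.log_inv] at h2
      rw [hp]; linarith
  · have h1 : ‖z - w‖ ≤ 2 * R * max 1 ‖w‖ := by
      have := norm_sub_le z w
      nlinarith [le_max_left 1 ‖w‖, le_max_right 1 ‖w‖]
    have h2 := Real.log_le_log hpos h1
    rw [Real.log_mul (by positivity) hm.ne'] at h2
    rw [hp]; linarith

theorem integrableOn_log_norm_sub (R : ℝ) (w : ℂ) :
    IntegrableOn (fun z : ℂ => Real.log ‖z - w‖) (Metric.closedBall 0 R) := by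
  have key (R : ℝ) (hR : 1 ≤ R) :
      IntegrableOn (fun z : ℂ => Real.log ‖z - w‖) (Metric.closedBall 0 R) := by
    refine ((((integrableOn_inv_norm_sub R w).const_mul 1).add (integrable_const
      (Real.log (4 * R) + Real.log 1⁻¹))).add (integrable_const (Real.posLog ‖w‖))).mono'
      ((Real.measurable_log.comp (by fun_prop)).aestronglyMeasurable) ?_
    refine (ae_restrict_iff' Metric.isClosed_closedBall.measurableSet).2 (.of_forall fun z hz => ?_)
    have h1 := abs_log_norm_sub_sub_posLog_le hR one_pos le_rfl hz w
    have h2 := abs_sub_abs_le_abs_sub (Real.log ‖z - w‖) (Real.posLog ‖w‖)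
    rw [abs_of_nonneg Real.posLog_nonneg] at h2
    simp only [Real.norm_eq_abs, Pi.add_apply]
    linarith
  exact (key (max R 1) (le_max_right _ _)).mono_set
    (Metric.closedBall_subset_closedBall (le_max_left _ _))

/-! ### Logarithmic potentials of compactly supported functions -/

theorem HasCompactSupport.exists_forall_lt_norm_eq_zero {φ : ℂ → ℝ} (hc : HasCompactSupport φ) :
    ∃ R : ℝ, 0 < R ∧ ∀ z, R < ‖z‖ → φ z = 0 := by
  obtain ⟨R, hR⟩ := hc.isCompact.isBounded.subset_closedBall 0
  refine ⟨max R 1, by positivity, fun z hz => ?_⟩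
  by_contra h
  have := hR (subset_tsupport _ (Function.mem_support.2 h))
  rw [mem_closedBall_zero_iff] at this
  exact absurd hz (not_lt.2 (this.trans (le_max_left _ _)))

theorem circleAverage_eq_zero_of_lt_norm {φ : ℂ → ℝ} {R : ℝ} (hR : ∀ z, R < ‖z‖ → φ z = 0)
    {ρ : ℝ} {z : ℂ} (hz : R + |ρ| < ‖z‖) : Real.circleAverage φ z ρ = 0 := by
  have : ∀ θ, φ (circleMap z ρ θ) = 0 := fun θ => hR _ <| by
    have h1 : ‖circleMap z ρ θ - z‖ = |ρ| := by simp [circleMap]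
    have h2 := norm_sub_norm_le z (circleMap z ρ θ)
    rw [norm_sub_rev, h1] at h2
    linarith
  simp [Real.circleAverage_def, this]

theorem continuous_circleAverage_center {φ : ℂ → ℝ} (hφ : Continuous φ) (ρ : ℝ) :
    Continuous fun z => Real.circleAverage φ z ρ := by
  simp only [Real.circleAverage_def]
  refine Continuous.const_smul (M := ℝ) ?_ _
  apply intervalIntegral.continuous_parametric_intervalIntegral_of_continuous'
  simp only [circleMap, Function.uncurry_def]
  fun_prop

theorem hasCompactSupport_circleAverage {φ : ℂ → ℝ} (hc : HasCompactSupport φ) (ρ : ℝ) :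
    HasCompactSupport fun z => Real.circleAverage φ z ρ := by
  obtain ⟨R, -, hR⟩ := hc.exists_forall_lt_norm_eq_zero
  refine HasCompactSupport.intro (isCompact_closedBall (0 : ℂ) (R + |ρ|)) fun z hz => ?_
  rw [mem_closedBall_zero_iff, not_le] at hz
  exact circleAverage_eq_zero_of_lt_norm hR hz

/-- Continuous compactly supported functions are integrable against `log |z - w|`. -/
theorem integrable_mul_log_norm_sub {ψ : ℂ → ℝ} (hψ : Continuous ψ) (hc : HasCompactSupport ψ)
    (w : ℂ) : Integrable fun z => ψ z * Real.log ‖z - w‖ := by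
  obtain ⟨R, -, hR⟩ := hc.exists_forall_lt_norm_eq_zero
  obtain ⟨M, hM⟩ := hψ.bounded_above_of_compact_support hc
  have h1 : IntegrableOn (fun z => ψ z * Real.log ‖z - w‖) (Metric.closedBall 0 R) :=
    (integrableOn_log_norm_sub R w).bdd_mul hψ.aestronglyMeasurable (.of_forall hM)
  refine (integrableOn_iff_integrable_of_support_subset fun z hz => ?_).1 h1
  rw [mem_closedBall_zero_iff]
  by_contra h
  exact hz (by simp [hR z (not_le.1 h)])

open Real in
/-- Smearing the pole of the logarithm over a circle is the same as averaging the density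
over circles. -/
theorem integral_mul_circleAverage_log {φ : ℂ → ℝ} (hφ : Continuous φ)
    (hc : HasCompactSupport φ) (ρ : ℝ) (w : ℂ) :
    ∫ c, φ c * circleAverage (fun z => log ‖z - w‖) c ρ =
      ∫ z, circleAverage φ z ρ * log ‖z - w‖ := by
  obtain ⟨R, hR0, hR⟩ := hc.exists_forall_lt_norm_eq_zero
  obtain ⟨M, hM⟩ := hφ.bounded_above_of_compact_support hc
  set ν : Measure ℝ := volume.restrict (Set.uIoc 0 (2 * π)) with hν
  have hνfin : IsFiniteMeasure ν := isFiniteMeasure_restrict.2 (by simp [Set.uIoc])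
  set g : ℂ → ℝ → ℝ := fun z θ => φ (circleMap z (-ρ) θ) * log ‖z - w‖ with hg
  set f : ℂ → ℝ → ℝ := fun c θ => φ c * log ‖circleMap c ρ θ - w‖ with hf
  have hgm : Measurable (Function.uncurry g) := by
    refine Measurable.mul (Continuous.measurable ?_) (Real.measurable_log.comp (by fun_prop))
    simp only [circleMap]
    fun_prop
  have hfm : Measurable (Function.uncurry f) := by
    refine Measurable.mul (hφ.measurable.comp measurable_fst)
      (Real.measurable_log.comp (Continuous.measurable ?_))
    simp only [circleMap]
    fun_prop
  have hgi : Integrable (Function.uncurry g) (volume.prod ν) := by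
    have h0 : Integrable (fun z => (Metric.closedBall (0 : ℂ) (R + |ρ|)).indicator
        (fun z => M * |log ‖z - w‖|) z) :=
      (integrable_indicator_iff Metric.isClosed_closedBall.measurableSet).2
        ((integrableOn_log_norm_sub _ w).abs.const_mul M)
    refine (h0.comp_fst ν).mono' hgm.aestronglyMeasurable (.of_forall fun ⟨z, θ⟩ => ?_)
    simp only [Function.uncurry, hg, norm_mul, norm_eq_abs]
    by_cases hz : z ∈ Metric.closedBall (0 : ℂ) (R + |ρ|)
    · rw [Set.indicator_of_mem hz]
      exact mul_le_mul_of_nonneg_right (hM _) (abs_nonneg _)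
    · rw [Set.indicator_of_notMem hz]
      rw [mem_closedBall_zero_iff, not_le] at hz
      rw [hR, abs_zero, zero_mul]
      have h1 : ‖circleMap z (-ρ) θ - z‖ = |ρ| := by simp [circleMap]
      have h2 := norm_sub_norm_le z (circleMap z (-ρ) θ)
      rw [norm_sub_rev, h1] at h2
      linarith
  have hshift : ∀ θ c, f c θ = g (c + circleMap 0 ρ θ) θ := fun θ c => by
    simp only [hf, hg, circleMap, Complex.ofReal_neg]
    congr 2 <;> ring_nf
  have hfi : Integrable (Function.uncurry f) (volume.prod ν) := by
    rw [integrable_prod_iff' hfm.aestronglyMeasurable]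
    rw [integrable_prod_iff' hgm.aestronglyMeasurable] at hgi
    refine ⟨hgi.1.mono fun θ hθ => ?_, hgi.2.congr (.of_forall fun θ => ?_)⟩
    · simp only [Function.uncurry, hshift]
      exact hθ.comp_add_right (circleMap 0 ρ θ)
    · simp only [Function.uncurry, hshift]
      exact (integral_add_right_eq_self (fun z => ‖g z θ‖) (circleMap 0 ρ θ)).symm
  have h2π : (0 : ℝ) ≤ 2 * π := by positivity
  have hL : ∀ c, φ c * circleAverage (fun z => log ‖z - w‖) c ρ =
      (2 * π)⁻¹ * ∫ θ, f c θ ∂ν := fun c => by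
    rw [circleAverage_def, intervalIntegral.integral_of_le h2π, hν, Set.uIoc_of_le h2π, hf,
      integral_const_mul, smul_eq_mul]
    ring
  have hRt : ∀ z, circleAverage φ z ρ * log ‖z - w‖ =
      (2 * π)⁻¹ * ∫ θ, g z θ ∂ν := fun z => by
    rw [← circleAverage_neg_radius, circleAverage_def, intervalIntegral.integral_of_le h2π, hν,
      Set.uIoc_of_le h2π, hg, integral_mul_const, smul_eq_mul]
    ring
  simp only [hL, hRt, integral_const_mul]
  congr 1
  rw [integral_integral_swap hfi, integral_integral_swap hgi]
  refine integral_congr_ae (.of_forall fun θ => ?_)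
  simp only [hshift]
  exact integral_add_right_eq_self (fun z => g z θ) (circleMap 0 ρ θ)

open Real in
/-- The difference of the logarithmic potentials of the uniform measures on the circles of radii
`ρ` and `ρ / e` around the origin, namely `1 + log⁺ (|v| / ρ) - log⁺ (e |v| / ρ)`: a bump
supported in the disc of radius `ρ`. -/
noncomputable def logBump (ρ : ℝ) (v : ℂ) : ℝ :=
  1 + log⁺ (ρ⁻¹ * ‖v‖) - log⁺ ((ρ / rexp 1)⁻¹ * ‖v‖)

open Real in
theorem logBump_eq (ρ : ℝ) (hρ : 0 < ρ) (v : ℂ) :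
    logBump ρ v = 1 + log (max 1 (ρ⁻¹ * ‖v‖)) - log (max 1 (rexp 1 * (ρ⁻¹ * ‖v‖))) := by
  have : (ρ / rexp 1)⁻¹ * ‖v‖ = rexp 1 * (ρ⁻¹ * ‖v‖) := by field_simp
  rw [logBump, this, posLog_eq_log_max_one (by positivity), posLog_eq_log_max_one (by positivity)]

open Real in
theorem logBump_nonneg {ρ : ℝ} (hρ : 0 < ρ) (v : ℂ) : 0 ≤ logBump ρ v := by
  rw [logBump_eq ρ hρ]
  have h : log (max 1 (rexp 1 * (ρ⁻¹ * ‖v‖))) ≤ log (rexp 1 * max 1 (ρ⁻¹ * ‖v‖)) := by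
    refine log_le_log (by positivity) (max_le ?_ ?_)
    · nlinarith [le_max_left 1 (ρ⁻¹ * ‖v‖), one_le_exp (zero_le_one (α := ℝ)), exp_pos 1]
    · gcongr; exact le_max_right _ _
  rw [log_mul (by positivity) (by positivity), log_exp] at h
  linarith

open Real in
theorem logBump_eq_zero {ρ : ℝ} (hρ : 0 < ρ) {v : ℂ} (hv : ρ ≤ ‖v‖) : logBump ρ v = 0 := by
  rw [logBump_eq ρ hρ]
  have h1 : 1 ≤ ρ⁻¹ * ‖v‖ := by rw [inv_mul_eq_div]; exact (one_le_div hρ).2 hv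
  have h2 : 1 ≤ rexp 1 * (ρ⁻¹ * ‖v‖) := by nlinarith [one_le_exp (zero_le_one (α := ℝ))]
  rw [max_eq_right h1, max_eq_right h2, log_mul (exp_pos 1).ne' (by positivity), log_exp]
  ring

theorem continuous_logBump {ρ : ℝ} (hρ : 0 < ρ) : Continuous (logBump ρ) := by
  rw [show logBump ρ = _ from funext (logBump_eq ρ hρ)]
  have h : ∀ x : ℝ, max 1 x ≠ 0 := fun x => by positivity
  refine (Continuous.add continuous_const ?_).sub ?_
  · exact Continuous.log (by fun_prop) fun _ => h _
  · exact Continuous.log (by fun_prop) fun _ => h _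

theorem hasCompactSupport_logBump {ρ : ℝ} (hρ : 0 < ρ) : HasCompactSupport (logBump ρ) := by
  refine HasCompactSupport.intro (isCompact_closedBall (0 : ℂ) ρ) fun v hv => ?_
  rw [mem_closedBall_zero_iff, not_le] at hv
  exact logBump_eq_zero hρ hv.le

theorem integral_logBump_pos {ρ : ℝ} (hρ : 0 < ρ) : 0 < ∫ v, logBump ρ v :=
  (continuous_logBump hρ).integral_pos_of_hasCompactSupport_nonneg_nonzero
    (hasCompactSupport_logBump hρ) (logBump_nonneg hρ) (x := 0) (by simp [logBump])

open Real in
/-- Logarithmic potentials of continuous compactly supported densities approximate every continuous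
compactly supported function uniformly: the potential below is `φ` convolved with the normalised
bump `logBump ρ`, for small `ρ`. -/
theorem exists_log_potential_approx {φ : ℂ → ℝ} (hφ : Continuous φ) (hc : HasCompactSupport φ)
    {ε : ℝ} (hε : 0 < ε) :
    ∃ ψ : ℂ → ℝ, Continuous ψ ∧ HasCompactSupport ψ ∧
      ∀ w, |(∫ z, ψ z * log ‖z - w‖) - φ w| ≤ ε := by
  obtain ⟨δ, hδ, hδφ⟩ := Metric.uniformContinuous_iff.1
    (hc.uniformContinuous_of_continuous hφ) ε hε
  set κ := ∫ v, logBump δ v with hκ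
  have κpos : 0 < κ := integral_logBump_pos hδ
  have hδ' : 0 < δ / rexp 1 := by positivity
  have hψc : Continuous fun z => circleAverage φ z δ - circleAverage φ z (δ / rexp 1) :=
    (continuous_circleAverage_center hφ _).sub (continuous_circleAverage_center hφ _)
  refine ⟨fun z => κ⁻¹ * (circleAverage φ z δ - circleAverage φ z (δ / rexp 1)),
    continuous_const.mul hψc, HasCompactSupport.mul_left
    ((hasCompactSupport_circleAverage hc _).sub (hasCompactSupport_circleAverage hc _)),
    fun w => ?_⟩
  have hI (r : ℝ) := integrable_mul_log_norm_sub (continuous_circleAverage_center hφ r)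
    (hasCompactSupport_circleAverage hc r) w
  have hJ (r : ℝ) (hr : 0 < r) :
      Integrable fun c => φ c * circleAverage (fun z => log ‖z - w‖) c r := by
    refine Continuous.integrable_of_hasCompactSupport ?_ hc.mul_right
    have (c : ℂ) := circleAverage_log_norm_sub_const_eq_log_radius_add_posLog (c := c) (a := w)
      hr.ne'
    simp only [this]
    refine hφ.mul (continuous_const.add ?_)
    simp only [posLog_eq_log_max_one (show 0 ≤ r⁻¹ * ‖_ - w‖ by positivity)]
    exact Continuous.log (by fun_prop) fun _ => by positivity
  have h1 : ∫ z, κ⁻¹ * (circleAverage φ z δ - circleAverage φ z (δ / rexp 1)) * log ‖z - w‖ =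
      κ⁻¹ * ∫ v, φ (v + w) * logBump δ v := by
    simp only [mul_assoc, sub_mul]
    rw [integral_const_mul, integral_sub (hI _) (hI _), ← integral_mul_circleAverage_log hφ hc,
      ← integral_mul_circleAverage_log hφ hc, ← integral_sub (hJ _ hδ) (hJ _ hδ'),
      ← integral_add_right_eq_self _ w]
    congr 1
    refine integral_congr_ae (.of_forall fun v => ?_)
    simp only
    rw [circleAverage_log_norm_sub_const_eq_log_radius_add_posLog hδ.ne',
      circleAverage_log_norm_sub_const_eq_log_radius_add_posLog hδ'.ne', add_sub_cancel_right,
      logBump, log_div hδ.ne' (exp_pos 1).ne', log_exp]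
    ring
  have hb : Integrable (logBump δ) :=
    (continuous_logBump hδ).integrable_of_hasCompactSupport (hasCompactSupport_logBump hδ)
  have hφb : Integrable fun v => φ (v + w) * logBump δ v :=
    ((hφ.comp (continuous_add_const w)).mul (continuous_logBump hδ)).integrable_of_hasCompactSupport
      (hasCompactSupport_logBump hδ).mul_left
  have h2 : κ⁻¹ * (∫ v, φ (v + w) * logBump δ v) - φ w =
      κ⁻¹ * ∫ v, (φ (v + w) - φ w) * logBump δ v := by
    simp only [sub_mul]
    rw [integral_sub hφb (hb.const_mul _), integral_const_mul, ← hκ, mul_sub]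
    field_simp
  rw [h1, h2, abs_mul, abs_of_pos (inv_pos.2 κpos), inv_mul_le_iff₀ κpos]
  calc |∫ v, (φ (v + w) - φ w) * logBump δ v| ≤ ∫ v, logBump δ v * ε := by
        rw [← norm_eq_abs]
        refine norm_integral_le_of_norm_le (hb.mul_const ε) (.of_forall fun v => ?_)
        rw [norm_mul, norm_of_nonneg (logBump_nonneg hδ v), mul_comm]
        rcases lt_or_ge ‖v‖ δ with hv | hv
        · refine mul_le_mul_of_nonneg_left ?_ (logBump_nonneg hδ v)
          have := hδφ (a := v + w) (b := w) (by simpa [dist_eq_norm] using hv)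
          rw [← dist_eq_norm]; exact this.le
        · rw [logBump_eq_zero hδ hv]; simp
    _ = κ * ε := by rw [integral_mul_const]

/-! ### The logarithmic derivative of the polynomial -/

/-- The logarithmic derivative `P' / P = ∑ 1 / (x - z k)` of `rootPoly z n`, where a term with
`x = z k` counts as zero. -/
noncomputable def cauchySum (z : ℕ → ℂ) (n : ℕ) (x : ℂ) : ℂ :=
  ∑ k ∈ Finset.range n, (x - z k)⁻¹

/-- The logarithmic potential `∑ log |x - w|` of a multiset of points `w`. -/
noncomputable def logSum (s : Multiset ℂ) (x : ℂ) : ℝ :=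
  (s.map fun w => Real.log ‖x - w‖).sum

theorem log_norm_multiset_prod {s : Multiset ℂ} {x : ℂ} (hx : x ∉ s) :
    Real.log ‖(s.map fun w => x - w).prod‖ = logSum s x := by
  induction s using Multiset.induction_on with
  | empty => simp [logSum]
  | cons a s ih =>
    rw [Multiset.mem_cons, not_or] at hx
    have h1 : x - a ≠ 0 := sub_ne_zero.2 hx.1
    have h2 : (s.map fun w => x - w).prod ≠ 0 := by
      rw [Ne, Multiset.prod_eq_zero_iff, Multiset.mem_map]
      rintro ⟨w, hw, h⟩
      exact hx.2 (sub_eq_zero.1 h ▸ hw)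
    simp only [logSum, Multiset.map_cons, Multiset.prod_cons, Multiset.sum_cons, norm_mul]
    rw [Real.log_mul (norm_ne_zero_iff.2 h1) (norm_ne_zero_iff.2 h2), ih hx.2, logSum]

theorem rootPoly_monic (z : ℕ → ℂ) (n : ℕ) : (rootPoly z n).Monic :=
  monic_prod_of_monic _ _ fun k _ => monic_X_sub_C (z k)

theorem rootPoly_natDegree (z : ℕ → ℂ) (n : ℕ) : (rootPoly z n).natDegree = n := by
  simp [rootPoly, natDegree_prod_of_monic _ _ (fun k _ => monic_X_sub_C (z k))]

theorem rootPoly_roots (z : ℕ → ℂ) (n : ℕ) :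
    (rootPoly z n).roots = (Multiset.range n).map z := by
  have : rootPoly z n = (((Multiset.range n).map z).map fun a => X - C a).prod := by
    rw [Multiset.map_map]; rfl
  rw [this, roots_multiset_prod_X_sub_C]

theorem leadingCoeff_derivative_rootPoly (z : ℕ → ℂ) (n : ℕ) :
    (derivative (rootPoly z n)).leadingCoeff = n := by
  rcases n with _ | n
  · simp [rootPoly]
  have h1 : (rootPoly z (n + 1)).coeff (n + 1) = 1 := by
    simpa [Monic, leadingCoeff, rootPoly_natDegree] using rootPoly_monic z (n + 1)
  rw [leadingCoeff, natDegree_derivative, rootPoly_natDegree, coeff_derivative,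
    Nat.add_sub_cancel, h1]
  push_cast
  ring

theorem cauchySum_eq_div {z : ℕ → ℂ} {n : ℕ} {x : ℂ} (hx : x ∉ (rootPoly z n).roots) :
    cauchySum z n x = (derivative (rootPoly z n)).eval x / (rootPoly z n).eval x := by
  have h0 : (rootPoly z n).eval x ≠ 0 := fun h =>
    hx ((mem_roots (rootPoly_monic z n).ne_zero).2 h)
  rw [(IsAlgClosed.splits _).eval_derivative_div_eval_of_ne_zero h0, rootPoly_roots,
    Multiset.map_map, cauchySum, Finset.sum]
  simp

theorem log_norm_cauchySum {z : ℕ → ℂ} {n : ℕ} (hn : n ≠ 0) {x : ℂ}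
    (hx : x ∉ (rootPoly z n).roots) (hx' : x ∉ criticalPoints z n) :
    Real.log ‖cauchySum z n x‖ =
      Real.log n + logSum (criticalPoints z n) x - logSum (rootPoly z n).roots x := by
  have h1 := (IsAlgClosed.splits (derivative (rootPoly z n))).eval_eq_prod_roots x
  have h2 := (IsAlgClosed.splits (rootPoly z n)).eval_eq_prod_roots x
  rw [leadingCoeff_derivative_rootPoly, ← criticalPoints] at h1
  rw [(rootPoly_monic z n).leadingCoeff, one_mul] at h2
  have hne {s : Multiset ℂ} (hs : x ∉ s) : ‖(s.map fun w => x - w).prod‖ ≠ 0 := by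
    rw [norm_ne_zero_iff, Ne, Multiset.prod_eq_zero_iff, Multiset.mem_map]
    rintro ⟨w, hw, h⟩
    exact hs (sub_eq_zero.1 h ▸ hw)
  rw [cauchySum_eq_div hx, norm_div, h1, h2, norm_mul, Complex.norm_natCast,
    Real.log_div (mul_ne_zero (by exact_mod_cast hn) (hne hx')) (hne hx),
    Real.log_mul (by exact_mod_cast hn) (hne hx'), log_norm_multiset_prod hx,
    log_norm_multiset_prod hx']

theorem ae_notMem_multiset (s : Multiset ℂ) : ∀ᵐ x : ℂ, x ∉ s := by
  have : (s.toFinset : Set ℂ)ᶜ ∈ ae (volume : Measure ℂ) :=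
    compl_mem_ae_iff.2 (s.toFinset.finite_toSet.measure_zero _)
  filter_upwards [this] with x hx
  simpa using hx

theorem ae_log_norm_cauchySum (z : ℕ → ℂ) {n : ℕ} (hn : n ≠ 0) :
    ∀ᵐ x : ℂ, Real.log ‖cauchySum z n x‖ =
      Real.log n + logSum (criticalPoints z n) x - logSum (rootPoly z n).roots x := by
  filter_upwards [ae_notMem_multiset (rootPoly z n).roots,
    ae_notMem_multiset (criticalPoints z n)] with x h1 h2 using log_norm_cauchySum hn h1 h2

theorem measurable_cauchySum (z : ℕ → ℂ) (n : ℕ) : Measurable (cauchySum z n) := by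
  unfold cauchySum
  fun_prop

/-! ### Vanishing of the normalised logarithm of the logarithmic derivative -/

/-- The potential `∑ (log |x - w| - log⁺ |w|)` of a multiset of points `w`, normalised so that
points near infinity contribute little. -/
noncomputable def normalizedLogSum (s : Multiset ℂ) (x : ℂ) : ℝ :=
  (s.map fun w => Real.log ‖x - w‖ - Real.posLog ‖w‖).sum

theorem logSum_eq_normalizedLogSum_add (s : Multiset ℂ) (x : ℂ) :
    logSum s x = normalizedLogSum s x + (s.map fun w => Real.posLog ‖w‖).sum := by
  simp [logSum, normalizedLogSum, Multiset.sum_map_sub]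

theorem integrableOn_normalizedLogSum (R : ℝ) (s : Multiset ℂ) :
    IntegrableOn (normalizedLogSum s) (Metric.closedBall 0 R) := by
  induction s using Multiset.induction_on with
  | empty => 
    rw [show normalizedLogSum 0 = 0 from funext fun x => by simp [normalizedLogSum]]
    exact integrableOn_zero
  | cons a s ih =>
    simp only [funext fun x => show normalizedLogSum (a ::ₘ s) x =
      (Real.log ‖x - a‖ - Real.posLog ‖a‖) + normalizedLogSum s x by simp [normalizedLogSum]]
    exact ((integrableOn_log_norm_sub R a).sub (integrable_const _)).add ih

theorem integrableOn_logSum (R : ℝ) (s : Multiset ℂ) :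
    IntegrableOn (logSum s) (Metric.closedBall 0 R) := by
  rw [funext (logSum_eq_normalizedLogSum_add s)]
  exact (integrableOn_normalizedLogSum R s).add (integrable_const _)

/-- Uniform integrability of normalised potentials: the bound involves the points only through
their number. -/
theorem setIntegral_abs_normalizedLogSum_le {R : ℝ} (hR : 1 ≤ R) {C : ℝ}
    (hC : ∀ w : ℂ, ∫ z in Metric.closedBall 0 R, ‖z - w‖⁻¹ ≤ C)
    {η : ℝ} (hη : 0 < η) (hη1 : η ≤ 1) {B : Set ℂ} (hBR : B ⊆ Metric.closedBall 0 R)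
    (hB : MeasurableSet B) (s : Multiset ℂ) :
    ∫ x in B, |normalizedLogSum s x| ≤
      s.card * ((Real.log (4 * R) + Real.log η⁻¹) * volume.real B + η * C) := by
  have hfinB : IsFiniteMeasure (volume.restrict B) :=
    isFiniteMeasure_restrict.2 ((measure_mono hBR).trans_lt measure_closedBall_lt_top).ne
  have hi (s) := (integrableOn_normalizedLogSum R s).mono_set hBR
  have hiw (w : ℂ) := (integrableOn_inv_norm_sub R w).mono_set hBR
  induction s using Multiset.induction_on with
  | empty => simp [normalizedLogSum]
  | cons a s ih =>
    have hia : IntegrableOn (fun x => (Real.log (4 * R) + Real.log η⁻¹) + η * ‖x - a‖⁻¹) B :=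
      (integrable_const _).add ((hiw a).const_mul η)
    calc _ ≤ ∫ x in B, (((Real.log (4 * R) + Real.log η⁻¹) + η * ‖x - a‖⁻¹)
            + |normalizedLogSum s x|) := by
          refine setIntegral_mono_on (hi _).abs (hia.add (hi s).abs) hB fun x hx => ?_
          have h1 := abs_log_norm_sub_sub_posLog_le hR hη hη1 (hBR hx) a
          have h2 : normalizedLogSum (a ::ₘ s) x =
            (Real.log ‖x - a‖ - Real.posLog ‖a‖) + normalizedLogSum s x := by
              simp [normalizedLogSum]
          rw [h2]
          exact (abs_add_le _ _).trans (by gcongr)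
      _ = (Real.log (4 * R) + Real.log η⁻¹) * volume.real B + η * (∫ x in B, ‖x - a‖⁻¹)
            + ∫ x in B, |normalizedLogSum s x| := by
          rw [integral_add hia (hi s).abs, integral_add (integrable_const _)
            ((hiw a).const_mul η), integral_const_mul, integral_const, smul_eq_mul,
            measureReal_restrict_apply_univ, mul_comm (volume.real B)]
      _ ≤ (Real.log (4 * R) + Real.log η⁻¹) * volume.real B + η * C + _ := by
          refine add_le_add (add_le_add_right (mul_le_mul_of_nonneg_left ?_ hη.le) _) ih
          refine le_trans (setIntegral_mono_set (integrableOn_inv_norm_sub R a)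
            (.of_forall fun x => by positivity) hBR.eventuallyLE) (hC a)
      _ = _ := by rw [Multiset.card_cons]; push_cast; ring

theorem integrableOn_log_norm_cauchySum (R : ℝ) (z : ℕ → ℂ) {n : ℕ} (hn : n ≠ 0) :
    IntegrableOn (fun x => Real.log ‖cauchySum z n x‖) (Metric.closedBall 0 R) := by
  refine Integrable.congr (((integrable_const (Real.log n)).add
    (integrableOn_logSum R (criticalPoints z n))).sub
      (integrableOn_logSum R (rootPoly z n).roots)) ?_
  filter_upwards [ae_restrict_of_ae (ae_log_norm_cauchySum z hn)] with x hx using hx.symm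

theorem setIntegral_norm_cauchySum_le {R C : ℝ}
    (hC : ∀ w : ℂ, ∫ z in Metric.closedBall 0 R, ‖z - w‖⁻¹ ≤ C) (z : ℕ → ℂ) (n : ℕ) :
    IntegrableOn (fun x => ‖cauchySum z n x‖) (Metric.closedBall 0 R) ∧
      ∫ x in Metric.closedBall 0 R, ‖cauchySum z n x‖ ≤ n * C := by
  have hsum : IntegrableOn (fun x => ∑ k ∈ Finset.range n, ‖x - z k‖⁻¹)
      (Metric.closedBall 0 R) :=
    integrable_finsetSum _ fun k _ => integrableOn_inv_norm_sub R (z k)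
  have hle (x : ℂ) : ‖cauchySum z n x‖ ≤ ∑ k ∈ Finset.range n, ‖x - z k‖⁻¹ := by
    refine (norm_sum_le _ _).trans_eq ?_
    simp
  have hi : IntegrableOn (fun x => ‖cauchySum z n x‖) (Metric.closedBall 0 R) :=
    hsum.mono' (measurable_cauchySum z n).norm.aestronglyMeasurable
      (.of_forall fun x => by simpa using hle x)
  refine ⟨hi, (integral_mono hi hsum hle).trans ?_⟩
  rw [integral_finsetSum _ fun k _ => integrableOn_inv_norm_sub R (z k)]
  refine (Finset.sum_le_sum fun k _ => hC (z k)).trans_eq ?_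
  simp

/-- The set where the logarithmic derivative of `rootPoly z n` is at most `1` in modulus. -/
def smallSet (z : ℕ → ℂ) (n : ℕ) : Set ℂ := {x | ‖cauchySum z n x‖ ≤ 1}

theorem measurableSet_smallSet (z : ℕ → ℂ) (n : ℕ) : MeasurableSet (smallSet z n) :=
  (measurable_cauchySum z n).norm measurableSet_Iic

/-- Where the logarithmic derivative exceeds `1`, its logarithm has an integral of order
`o(n)`, uniformly in the roots. -/
theorem setIntegral_abs_log_norm_cauchySum_le {R C : ℝ}
    (hC : ∀ w : ℂ, ∫ z in Metric.closedBall 0 R, ‖z - w‖⁻¹ ≤ C)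
    {η : ℝ} (hη : 0 < η) (hη1 : η ≤ 1) (z : ℕ → ℂ) {n : ℕ} (hn : n ≠ 0) :
    ∫ x in Metric.closedBall 0 R \ smallSet z n, |Real.log ‖cauchySum z n x‖| ≤
      n * (η * C) + Real.log η⁻¹ * volume.real (Metric.closedBall (0 : ℂ) R) := by
  obtain ⟨hi, hb⟩ := setIntegral_norm_cauchySum_le hC z n
  have hm : MeasurableSet (Metric.closedBall (0 : ℂ) R \ smallSet z n) :=
    Metric.isClosed_closedBall.measurableSet.diff (measurableSet_smallSet z n)
  have hi2 : IntegrableOn (fun x => η * ‖cauchySum z n x‖ + Real.log η⁻¹)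
      (Metric.closedBall 0 R) := (hi.const_mul η).add (integrable_const _)
  have hlog : 0 ≤ Real.log η⁻¹ := Real.log_nonneg ((one_le_inv₀ hη).2 hη1)
  calc _ ≤ ∫ x in Metric.closedBall 0 R \ smallSet z n, (η * ‖cauchySum z n x‖ + Real.log η⁻¹) := by
        refine setIntegral_mono_on ((integrableOn_log_norm_cauchySum R z hn).mono_set
          Set.sdiff_subset).abs (hi2.mono_set Set.sdiff_subset) hm fun x hx => ?_
        have h1 : 1 < ‖cauchySum z n x‖ := not_le.1 hx.2
        rw [abs_of_nonneg (Real.log_nonneg h1.le)]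
        exact log_le_mul_add_log_inv hη (by linarith)
    _ ≤ ∫ x in Metric.closedBall 0 R, (η * ‖cauchySum z n x‖ + Real.log η⁻¹) :=
        setIntegral_mono_set hi2 (.of_forall fun x => by positivity) Set.sdiff_subset.eventuallyLE
    _ = η * (∫ x in Metric.closedBall 0 R, ‖cauchySum z n x‖) +
          Real.log η⁻¹ * volume.real (Metric.closedBall (0 : ℂ) R) := by
        rw [integral_add (hi.const_mul η) (integrable_const _), integral_const_mul,
          integral_const, smul_eq_mul, measureReal_restrict_apply_univ, mul_comm (volume.real _)]
    _ ≤ _ := by nlinarith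

/-- An estimate for fixed `n`. The additive constant `b` in the decomposition of
`log |P' / P|` into normalised potentials is of order `n`, because the integral of the logarithm
is under control off the small set, which is not the whole disc; on the small set it then
contributes little, and so do the potentials. -/
theorem integral_abs_log_norm_cauchySum_le {R C : ℝ} (hR : 1 ≤ R)
    (hC : ∀ w : ℂ, ∫ z in Metric.closedBall 0 R, ‖z - w‖⁻¹ ≤ C)
    {η : ℝ} (hη : 0 < η) (hη1 : η ≤ 1) (z : ℕ → ℂ) {n : ℕ} (hn : n ≠ 0) {m a : ℝ}
    (hm : m = volume.real (Metric.closedBall (0 : ℂ) R))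
    (ha : a = volume.real (Metric.closedBall (0 : ℂ) R ∩ smallSet z n)) (ham : a ≤ m / 2) :
    ∫ x in Metric.closedBall 0 R, |Real.log ‖cauchySum z n x‖| ≤
      n * (3 * C * η) + Real.log η⁻¹ * m +
        n * ((2 / m * (C + 2 * (Real.log (4 * R) * m + C)) +
          2 * (Real.log (4 * R) + Real.log η⁻¹)) * a) := by
  set D := Metric.closedBall (0 : ℂ) R with hD
  have mpos : 0 < m := by
    rw [hm, measureReal_def, ENNReal.toReal_pos_iff]
    exact ⟨Metric.measure_closedBall_pos _ _ (by linarith), measure_closedBall_lt_top⟩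
  have hDm : MeasurableSet D := Metric.isClosed_closedBall.measurableSet
  have hAm := measurableSet_smallSet z n
  have hi := integrableOn_log_norm_cauchySum R z hn
  set g : ℂ → ℝ := fun x => normalizedLogSum (criticalPoints z n) x -
    normalizedLogSum (rootPoly z n).roots x with hg
  set b : ℝ := Real.log n + ((criticalPoints z n).map fun w => Real.posLog ‖w‖).sum -
    ((rootPoly z n).roots.map fun w => Real.posLog ‖w‖).sum with hb
  have hgi : IntegrableOn g D :=
    (integrableOn_normalizedLogSum R _).sub (integrableOn_normalizedLogSum R _)
  have hbg : ∀ᵐ x : ℂ, Real.log ‖cauchySum z n x‖ = b + g x := by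
    filter_upwards [ae_log_norm_cauchySum z hn] with x hx
    rw [hx, logSum_eq_normalizedLogSum_add, logSum_eq_normalizedLogSum_add]
    ring
  have hC0 : 0 ≤ C := (integral_nonneg fun _ => by positivity).trans (hC 0)
  have hgB {η : ℝ} (hη : 0 < η) (hη1 : η ≤ 1) {B : Set ℂ} (hBD : B ⊆ D) (hB : MeasurableSet B) :
      ∫ x in B, |g x| ≤
        n * (2 * ((Real.log (4 * R) + Real.log η⁻¹) * volume.real B + η * C)) := by
    have hlogR : 0 ≤ Real.log (4 * R) := Real.log_nonneg (by linarith)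
    have hlogη : 0 ≤ Real.log η⁻¹ := Real.log_nonneg ((one_le_inv₀ hη).2 hη1)
    have h1 := setIntegral_abs_normalizedLogSum_le hR hC hη hη1 hBD hB (criticalPoints z n)
    have h2 := setIntegral_abs_normalizedLogSum_le hR hC hη hη1 hBD hB (rootPoly z n).roots
    rw [card_criticalPoints] at h1
    have hc : (rootPoly z n).roots.card = n := by rw [rootPoly_roots]; simp
    rw [hc] at h2
    have h3 : ((n - 1 : ℕ) : ℝ) ≤ n := by exact_mod_cast Nat.sub_le n 1
    have i1 := ((integrableOn_normalizedLogSum R (criticalPoints z n)).mono_set hBD).abs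
    have i2 := ((integrableOn_normalizedLogSum R (rootPoly z n).roots).mono_set hBD).abs
    calc ∫ x in B, |g x| ≤ ∫ x in B, (|normalizedLogSum (criticalPoints z n) x| +
            |normalizedLogSum (rootPoly z n).roots x|) :=
          integral_mono (hgi.mono_set hBD).abs (i1.add i2) fun x => abs_sub _ _
      _ = _ := integral_add i1 i2
      _ ≤ n * ((Real.log (4 * R) + Real.log η⁻¹) * volume.real B + η * C) +
            n * ((Real.log (4 * R) + Real.log η⁻¹) * volume.real B + η * C) :=
          add_le_add (h1.trans (mul_le_mul_of_nonneg_right h3 (by positivity))) h2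
      _ = _ := by ring
  have hsplit : ∫ x in D, |Real.log ‖cauchySum z n x‖| =
      (∫ x in D ∩ smallSet z n, |Real.log ‖cauchySum z n x‖|) +
        ∫ x in D \ smallSet z n, |Real.log ‖cauchySum z n x‖| :=
    (integral_inter_add_sdiff hAm hi.abs).symm
  have hbig := setIntegral_abs_log_norm_cauchySum_le hC hη hη1 z hn
  have hbig1 := setIntegral_abs_log_norm_cauchySum_le hC one_pos le_rfl z hn
  rw [← hD, ← hm] at hbig hbig1
  have hmeas : volume.real (D \ smallSet z n) = m - a := by
    have := measureReal_inter_add_sdiff (μ := volume) (s := D) hAm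
      (h := measure_closedBall_lt_top.ne)
    rw [← ha, ← hm] at this
    linarith
  -- the constant is estimated off the small set, where the logarithm has a controlled integral
  have hconst : |b| * (m / 2) ≤ n * (C + 2 * (Real.log (4 * R) * m + C)) := by
    have hgD := hgB one_pos le_rfl (subset_refl D) hDm
    have hgD' : ∫ x in D \ smallSet z n, |g x| ≤ ∫ x in D, |g x| :=
      setIntegral_mono_set hgi.abs (.of_forall fun x => abs_nonneg _) Set.sdiff_subset.eventuallyLE
    have i1 := (hi.mono_set (Set.sdiff_subset (t := smallSet z n))).abs
    have i2 := (hgi.mono_set (Set.sdiff_subset (t := smallSet z n))).abs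
    have : |b| * (m - a) ≤ (∫ x in D \ smallSet z n, |Real.log ‖cauchySum z n x‖|) +
        ∫ x in D \ smallSet z n, |g x| := by
      rw [← integral_add i1 i2, ← hmeas, mul_comm, ← smul_eq_mul, ← setIntegral_const]
      have : IsFiniteMeasure (volume.restrict (D \ smallSet z n)) :=
        isFiniteMeasure_restrict.2 ((measure_mono Set.sdiff_subset).trans_lt
          measure_closedBall_lt_top).ne
      refine integral_mono_ae (integrable_const _) (i1.add i2) ?_
      filter_upwards [ae_restrict_of_ae hbg] with x hx
      rw [hx]
      have := abs_sub (b + g x) (g x)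
      rwa [add_sub_cancel_right] at this
    rw [← hm] at hgD
    simp only [inv_one, Real.log_one, add_zero, one_mul, zero_mul] at hgD hbig1
    have hb0 := abs_nonneg b
    nlinarith
  have hbn : |b| ≤ n * (2 / m * (C + 2 * (Real.log (4 * R) * m + C))) := by
    rw [show n * (2 / m * (C + 2 * (Real.log (4 * R) * m + C))) =
      n * (C + 2 * (Real.log (4 * R) * m + C)) / (m / 2) by field_simp]
    exact (le_div_iff₀ (by positivity)).2 hconst
  have hsmall : ∫ x in D ∩ smallSet z n, |Real.log ‖cauchySum z n x‖| ≤
      |b| * a + ∫ x in D ∩ smallSet z n, |g x| := by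
    have i1 := (hi.mono_set (Set.inter_subset_left (t := smallSet z n))).abs
    have i2 := (hgi.mono_set (Set.inter_subset_left (t := smallSet z n))).abs
    have : IsFiniteMeasure (volume.restrict (D ∩ smallSet z n)) :=
      isFiniteMeasure_restrict.2 ((measure_mono Set.inter_subset_left).trans_lt
        measure_closedBall_lt_top).ne
    rw [ha, mul_comm, ← smul_eq_mul, ← setIntegral_const, ← integral_add (integrable_const _) i2]
    refine integral_mono_ae i1 ((integrable_const _).add i2) ?_
    filter_upwards [ae_restrict_of_ae hbg] with x hx
    rw [hx]
    exact abs_add_le _ _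
  have hgA := hgB hη hη1 (Set.inter_subset_left (s := D)) (hDm.inter hAm)
  rw [← ha] at hgA
  have ha0 : 0 ≤ a := ha ▸ measureReal_nonneg
  have := mul_le_mul_of_nonneg_right hbn ha0
  rw [hsplit]
  nlinarith

/-- If the set where `|P' / P| ≤ 1` becomes negligible, then `log |P' / P| / n` tends to zero in
`L¹` of a disc. -/
theorem tendsto_integral_abs_log_norm_cauchySum {R : ℝ} (hR : 1 ≤ R) (z : ℕ → ℂ)
    (h : Tendsto (fun n => volume (Metric.closedBall 0 R ∩ smallSet z n)) atTop (𝓝 0)) :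
    Tendsto (fun n : ℕ => (n : ℝ)⁻¹ *
      ∫ x in Metric.closedBall 0 R, |Real.log ‖cauchySum z n x‖|) atTop (𝓝 0) := by
  obtain ⟨C, hC0, hC⟩ := exists_setIntegral_inv_norm_sub_le R
  set m := volume.real (Metric.closedBall (0 : ℂ) R) with hm
  have mpos : 0 < m := by
    rw [hm, measureReal_def, ENNReal.toReal_pos_iff]
    exact ⟨Metric.measure_closedBall_pos _ _ (by linarith), measure_closedBall_lt_top⟩
  have ha : Tendsto (fun n => volume.real (Metric.closedBall 0 R ∩ smallSet z n)) atTop (𝓝 0) :=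
    (ENNReal.tendsto_toReal ENNReal.zero_ne_top).comp h
  refine tendsto_order.2 ⟨fun e he => .of_forall fun n => he.trans_le
    (mul_nonneg (by positivity) (integral_nonneg fun _ => abs_nonneg _)), fun ε hε => ?_⟩
  obtain ⟨η, hη, hη1, hηε⟩ : ∃ η : ℝ, 0 < η ∧ η ≤ 1 ∧ 3 * C * η < ε := by
    refine ⟨min 1 (ε / (3 * C + 1)), by positivity, min_le_left _ _, ?_⟩
    have : (3 * C) * min 1 (ε / (3 * C + 1)) ≤ (3 * C) * (ε / (3 * C + 1)) := by
      gcongr; exact min_le_right _ _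
    refine this.trans_lt ?_
    rw [mul_div_assoc', div_lt_iff₀ (by positivity)]
    nlinarith
  have hlim : Tendsto (fun n : ℕ => 3 * C * η + Real.log η⁻¹ * m * (n : ℝ)⁻¹ +
      (2 / m * (C + 2 * (Real.log (4 * R) * m + C)) + 2 * (Real.log (4 * R) + Real.log η⁻¹)) *
        volume.real (Metric.closedBall 0 R ∩ smallSet z n)) atTop (𝓝 (3 * C * η)) := by
    simpa using (tendsto_const_nhds.add (tendsto_inv_atTop_nhds_zero_nat.const_mul
      (Real.log η⁻¹ * m))).add (ha.const_mul _)
  filter_upwards [hlim.eventually (gt_mem_nhds hηε),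
    ha.eventually (ge_mem_nhds (half_pos mpos)), eventually_ne_atTop 0] with n h1 h2 hn
  refine lt_of_le_of_lt ?_ h1
  have := integral_abs_log_norm_cauchySum_le hR hC hη hη1 z hn hm rfl h2
  have hn' : (0 : ℝ) < n := by positivity
  rw [inv_mul_le_iff₀ hn']
  refine this.trans_eq ?_
  field_simp

/-! ### Comparison of the roots with the critical points -/

theorem integral_mul_logSum {ψ : ℂ → ℝ} (hψ : Continuous ψ) (hc : HasCompactSupport ψ)
    (s : Multiset ℂ) :
    Integrable (fun x => ψ x * logSum s x) ∧
      ∫ x, ψ x * logSum s x = (s.map fun w => ∫ x, ψ x * Real.log ‖x - w‖).sum := by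
  induction s using Multiset.induction_on with
  | empty => simp [logSum]
  | cons a s ih =>
    have h : ∀ x, ψ x * logSum (a ::ₘ s) x = ψ x * Real.log ‖x - a‖ + ψ x * logSum s x :=
      fun x => by simp [logSum, mul_add]
    have hi := integrable_mul_log_norm_sub hψ hc a
    simp only [h, Multiset.map_cons, Multiset.sum_cons]
    exact ⟨hi.add ih.1, by rw [integral_add hi ih.1, ih.2]⟩

theorem abs_sum_map_sub_le {f g : ℂ → ℝ} {ε : ℝ} (h : ∀ w, |f w - g w| ≤ ε) (s : Multiset ℂ) :
    |(s.map f).sum - (s.map g).sum| ≤ s.card * ε := by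
  rw [← Multiset.sum_map_sub]
  refine (Multiset.abs_sum_le_sum_abs (s := s.map fun i => f i - g i)).trans ?_
  rw [Multiset.map_map, ← nsmul_eq_mul]
  refine (Multiset.sum_le_card_nsmul _ ε fun x hx => ?_).trans_eq (by rw [Multiset.card_map])
  obtain ⟨w, -, rfl⟩ := Multiset.mem_map.1 hx
  exact h w

/-- If the set where `|P' / P| ≤ 1` becomes negligible on every disc, then roots and critical
points have asymptotically the same averages against compactly supported test functions. -/
theorem tendsto_sum_criticalPoints_sub_sum_roots (z : ℕ → ℂ)
    (h : ∀ R : ℝ, Tendsto (fun n => volume (Metric.closedBall 0 R ∩ smallSet z n)) atTop (𝓝 0))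
    {φ : ℂ → ℝ} (hφ : Continuous φ) (hc : HasCompactSupport φ) :
    Tendsto (fun n : ℕ => (n : ℝ)⁻¹ * (((criticalPoints z n).map φ).sum -
      ((rootPoly z n).roots.map φ).sum)) atTop (𝓝 0) := by
  rw [tendsto_zero_iff_abs_tendsto_zero]
  refine tendsto_order.2 ⟨fun e he => .of_forall fun n => he.trans_le (abs_nonneg _),
    fun ε hε => ?_⟩
  obtain ⟨ψ, hψ, hψc, hψφ⟩ := exists_log_potential_approx hφ hc (show 0 < ε / 3 by positivity)
  obtain ⟨R, hR0, hR⟩ := hψc.exists_forall_lt_norm_eq_zero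
  obtain ⟨M, hM⟩ := hψ.bounded_above_of_compact_support hψc
  have hM0 : 0 ≤ M := (norm_nonneg _).trans (hM 0)
  have hlim : Tendsto (fun n : ℕ => 2 * (ε / 3) + M * ((n : ℝ)⁻¹ *
      ∫ x in Metric.closedBall 0 (max R 1), |Real.log ‖cauchySum z n x‖|) +
      (∫ x, |ψ x|) * (Real.log n / n)) atTop (𝓝 (2 * (ε / 3))) := by
    have hlog : Tendsto (fun n : ℕ => Real.log n / n) atTop (𝓝 0) :=
      (Real.isLittleO_log_id_atTop.tendsto_div_nhds_zero).comp tendsto_natCast_atTop_atTop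
    simpa using (tendsto_const_nhds.add ((tendsto_integral_abs_log_norm_cauchySum
      (le_max_right R 1) z (h _)).const_mul M)).add (hlog.const_mul (∫ x, |ψ x|))
  filter_upwards [hlim.eventually (gt_mem_nhds (show 2 * (ε / 3) < ε by linarith)),
    eventually_ne_atTop 0] with n hn1 hn
  refine lt_of_le_of_lt ?_ hn1
  have hn' : (0 : ℝ) < n := by positivity
  obtain ⟨iW, eW⟩ := integral_mul_logSum hψ hψc (criticalPoints z n)
  obtain ⟨iZ, eZ⟩ := integral_mul_logSum hψ hψc (rootPoly z n).roots
  set ΦW := ((criticalPoints z n).map fun w => ∫ x, ψ x * Real.log ‖x - w‖).sum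
  set ΦZ := ((rootPoly z n).roots.map fun w => ∫ x, ψ x * Real.log ‖x - w‖).sum
  have h1 := abs_sum_map_sub_le hψφ (criticalPoints z n)
  have h2 := abs_sum_map_sub_le hψφ (rootPoly z n).roots
  rw [card_criticalPoints] at h1
  have hcard : (rootPoly z n).roots.card = n := by rw [rootPoly_roots]; simp
  rw [hcard] at h2
  have h1' : ((n - 1 : ℕ) : ℝ) * (ε / 3) ≤ n * (ε / 3) := by
    gcongr; exact Nat.sub_le n 1
  have hψi : Integrable ψ := hψ.integrable_of_hasCompactSupport hψc
  have h3 : |ΦW - ΦZ| ≤ M * (∫ x in Metric.closedBall 0 (max R 1),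
      |Real.log ‖cauchySum z n x‖|) + (∫ x, |ψ x|) * Real.log n := by
    have hlogn : 0 ≤ Real.log n := Real.log_natCast_nonneg n
    have hind := (integrable_indicator_iff Metric.isClosed_closedBall.measurableSet).2
      ((integrableOn_log_norm_cauchySum (max R 1) z hn).abs)
    rw [← eW, ← eZ, ← integral_sub iW iZ, ← Real.norm_eq_abs, ← integral_indicator
      Metric.isClosed_closedBall.measurableSet, ← integral_const_mul, ← integral_mul_const,
      ← integral_add (hind.const_mul M) (hψi.abs.mul_const _)]
    refine norm_integral_le_of_norm_le ((hind.const_mul M).add (hψi.abs.mul_const _)) ?_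
    filter_upwards [ae_log_norm_cauchySum z hn] with x hx
    have e1 : ψ x * logSum (criticalPoints z n) x - ψ x * logSum (rootPoly z n).roots x =
        ψ x * Real.log ‖cauchySum z n x‖ - ψ x * Real.log n := by rw [hx]; ring
    rw [e1]
    refine (norm_sub_le _ _).trans (add_le_add ?_ (by
      rw [norm_mul, Real.norm_eq_abs, Real.norm_eq_abs, abs_of_nonneg hlogn]))
    by_cases hxR : x ∈ Metric.closedBall (0 : ℂ) (max R 1)
    · rw [Set.indicator_of_mem hxR, norm_mul]
      exact mul_le_mul_of_nonneg_right (hM x) (abs_nonneg _)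
    · rw [mem_closedBall_zero_iff, not_le] at hxR
      rw [hR x ((le_max_left _ _).trans_lt hxR), zero_mul, norm_zero]
      exact mul_nonneg hM0 (Set.indicator_nonneg (fun _ _ => abs_nonneg _) _)
  rw [Function.comp_apply, abs_mul, abs_of_pos (inv_pos.2 hn'), inv_mul_le_iff₀ hn']
  have e2 : (n : ℝ) * (2 * (ε / 3) + M * ((n : ℝ)⁻¹ *
      ∫ x in Metric.closedBall 0 (max R 1), |Real.log ‖cauchySum z n x‖|) +
      (∫ x, |ψ x|) * (Real.log n / n)) = 2 * (n * (ε / 3)) + (M *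
      (∫ x in Metric.closedBall 0 (max R 1), |Real.log ‖cauchySum z n x‖|) +
        (∫ x, |ψ x|) * Real.log n) := by
    field_simp
    ring
  rw [e2]
  rw [abs_le] at *
  constructor <;> linarith [h1.1, h1.2, h2.1, h2.2, h3.1, h3.2]

theorem integrable_and_integral_sum_dirac {φ : ℂ → ℝ} (s : Multiset ℂ) :
    Integrable φ (s.map Measure.dirac).sum ∧
      ∫ x, φ x ∂(s.map Measure.dirac).sum = (s.map φ).sum := by
  induction s using Multiset.induction_on with
  | empty => simp
  | cons a s ih =>
    have ha : Integrable φ (Measure.dirac a) := integrable_dirac (by simp)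
    simp only [Multiset.map_cons, Multiset.sum_cons]
    exact ⟨ha.add_measure ih.1, by rw [integral_add_measure ha ih.1, integral_dirac, ih.2]⟩

theorem integral_criticalMeasure (z : ℕ → ℂ) (n : ℕ) (φ : ℂ → ℝ) :
    ∫ x, φ x ∂(criticalMeasure z n) =
      ((n - 1 : ℕ) : ℝ)⁻¹ * ((criticalPoints z n).map φ).sum := by
  rw [criticalMeasure, integral_smul_measure, (integrable_and_integral_sum_dirac _).2,
    smul_eq_mul, ENNReal.toReal_inv, ENNReal.toReal_natCast]

/-- Convergence of the averages of compactly supported functions along a sequence of probability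
measures implies weak convergence when the limit is a probability measure as well. -/
theorem tendsto_probabilityMeasure_of_forall_hasCompactSupport {μ : ProbabilityMeasure ℂ}
    {ν : ℕ → ProbabilityMeasure ℂ}
    (h : ∀ φ : ℂ → ℝ, Continuous φ → HasCompactSupport φ →
      Tendsto (fun n => ∫ x, φ x ∂(ν n : Measure ℂ)) atTop (𝓝 (∫ x, φ x ∂(μ : Measure ℂ)))) :
    Tendsto ν atTop (𝓝 μ) := by
  refine tendsto_of_forall_isOpen_le_liminf' fun G hG => le_of_forall_lt fun r hr => ?_
  obtain ⟨K, hKG, hK, hrK⟩ := hG.exists_lt_isCompact hr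
  obtain ⟨f, hf1, hf0, hfc, hf01⟩ := exists_continuous_one_zero_of_isCompact hK
    hG.isClosed_compl (Set.disjoint_compl_right_iff_subset.2 hKG)
  have hfi (ν : ProbabilityMeasure ℂ) : Integrable f (ν : Measure ℂ) :=
    f.continuous.integrable_of_hasCompactSupport hfc
  have hupper (ν : ProbabilityMeasure ℂ) :
      ENNReal.ofReal (∫ x, f x ∂(ν : Measure ℂ)) ≤ (ν : Measure ℂ) G := by
    rw [ofReal_integral_eq_lintegral_ofReal (hfi ν) (.of_forall fun x => (hf01 x).1),
      ← lintegral_indicator_one hG.measurableSet]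
    refine lintegral_mono fun x => ?_
    by_cases hx : x ∈ G
    · rw [Set.indicator_of_mem hx]
      simpa using (hf01 x).2
    · have : f x = 0 := hf0 hx
      simp [this]
  have hlower : (μ : Measure ℂ) K ≤ ENNReal.ofReal (∫ x, f x ∂(μ : Measure ℂ)) := by
    rw [ofReal_integral_eq_lintegral_ofReal (hfi μ) (.of_forall fun x => (hf01 x).1),
      ← lintegral_indicator_one hK.measurableSet]
    refine lintegral_mono fun x => ?_
    by_cases hx : x ∈ K
    · have : f x = 1 := hf1 hx
      simp [this, Set.indicator_of_mem hx]
    · rw [Set.indicator_of_notMem hx]; exact zero_le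
  have hlim : Tendsto (fun n => ENNReal.ofReal (∫ x, f x ∂(ν n : Measure ℂ))) atTop
      (𝓝 (ENNReal.ofReal (∫ x, f x ∂(μ : Measure ℂ)))) :=
    ENNReal.tendsto_ofReal (h f f.continuous hfc)
  refine hrK.trans_le (hlower.trans ?_)
  rw [← hlim.liminf_eq]
  exact liminf_le_liminf (.of_forall fun n => hupper (ν n))

/-- A criterion for a fixed sequence of roots: when the logarithmic derivative is small on a
negligible set only, the critical points inherit the limit distribution of the roots. -/
theorem tendsto_criticalProbabilityMeasure {z : ℕ → ℂ} {μ : ProbabilityMeasure ℂ}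
    (h : ∀ R : ℝ, Tendsto (fun n => volume (Metric.closedBall 0 R ∩ smallSet z n)) atTop (𝓝 0))
    (hz : ∀ φ : ℂ → ℝ, Continuous φ → HasCompactSupport φ →
      Tendsto (fun n : ℕ => (n : ℝ)⁻¹ * ∑ k ∈ Finset.range n, φ (z k)) atTop
        (𝓝 (∫ x, φ x ∂(μ : Measure ℂ)))) :
    Tendsto (fun n : ℕ => criticalProbabilityMeasure z (n + 2) (Nat.le_add_left 2 n))
      atTop (𝓝 μ) := by
  refine tendsto_probabilityMeasure_of_forall_hasCompactSupport fun φ hφ hc => ?_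
  have h1 := (tendsto_sum_criticalPoints_sub_sum_roots z h hφ hc).add (hz φ hφ hc)
  rw [zero_add] at h1
  have h2 : Tendsto (fun n : ℕ => (n : ℝ)⁻¹ * ((criticalPoints z n).map φ).sum) atTop
      (𝓝 (∫ x, φ x ∂(μ : Measure ℂ))) := by
    refine h1.congr fun n => ?_
    have : ((rootPoly z n).roots.map φ).sum = ∑ k ∈ Finset.range n, φ (z k) := by
      rw [rootPoly_roots, Multiset.map_map]; rfl
    rw [this]
    ring
  have h3 : Tendsto (fun n : ℕ => 1 + ((n : ℝ) + 1)⁻¹) atTop (𝓝 1) := by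
    simpa using tendsto_const_nhds.add (tendsto_one_div_add_atTop_nhds_zero_nat (𝕜 := ℝ))
  have h4 := h3.mul (h2.comp (tendsto_add_atTop_nat 2))
  rw [one_mul] at h4
  refine h4.congr fun n => ?_
  change _ = ∫ x, φ x ∂(criticalMeasure z (n + 2))
  rw [integral_criticalMeasure]
  simp only [Function.comp_apply]
  push_cast [Nat.add_sub_cancel, show n + 2 - 1 = n + 1 by omega]
  field_simp
  ring

/-! ### Anticoncentration from characteristic functions -/

section charFun

variable {E : Type*} [NormedAddCommGroup E] [InnerProductSpace ℝ E] [MeasurableSpace E]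
  [BorelSpace E] [SecondCountableTopology E]

theorem integrable_cexp_inner (κ : Measure E) [IsFiniteMeasure κ] (t : E) :
    Integrable (fun x => Complex.exp (inner ℝ x t * Complex.I)) κ := by
  refine (integrable_const (1 : ℝ)).mono' (by fun_prop) (.of_forall fun x => ?_)
  rw [Complex.norm_exp_ofReal_mul_I]

theorem integral_charFun_comm (κ τ : Measure E) [IsFiniteMeasure κ] [IsFiniteMeasure τ] :
    ∫ x, charFun τ x ∂κ = ∫ t, charFun κ t ∂τ := by
  simp only [charFun_apply]
  rw [integral_integral_swap]
  · simp only [real_inner_comm]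
  · refine (integrable_const (1 : ℝ)).mono' (by fun_prop) (.of_forall fun x => ?_)
    simp only [Function.uncurry]
    rw [Complex.norm_exp_ofReal_mul_I]

theorem charFun_re (κ : Measure E) [IsFiniteMeasure κ] (t : E) :
    (charFun κ t).re = ∫ x, Real.cos (inner ℝ x t) ∂κ := by
  rw [charFun_apply, ← Complex.reCLM_apply, ← Complex.reCLM.integral_comp_comm
    (integrable_cexp_inner κ t)]
  simp [Complex.exp_ofReal_mul_I_re]

theorem charFun_im (κ : Measure E) [IsFiniteMeasure κ] (t : E) :
    (charFun κ t).im = ∫ x, Real.sin (inner ℝ x t) ∂κ := by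
  rw [charFun_apply, ← Complex.imCLM_apply, ← Complex.imCLM.integral_comp_comm
    (integrable_cexp_inner κ t)]
  simp [Complex.exp_ofReal_mul_I_im]

theorem norm_charFun_sq (κ : Measure E) [IsFiniteMeasure κ] (t : E) :
    ‖charFun κ t‖ ^ 2 = ∫ p, Real.cos (inner ℝ (p.1 - p.2) t) ∂(κ.prod κ) := by
  have hc : Integrable (fun x => Real.cos (inner ℝ x t)) κ :=
    (integrable_const (1 : ℝ)).mono' (by fun_prop) (.of_forall fun x => Real.abs_cos_le_one _)
  have hs : Integrable (fun x => Real.sin (inner ℝ x t)) κ :=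
    (integrable_const (1 : ℝ)).mono' (by fun_prop) (.of_forall fun x => Real.abs_sin_le_one _)
  simp only [inner_sub_left, Real.cos_sub]
  rw [integral_add (hc.mul_prod hc) (hs.mul_prod hs),
    integral_prod_mul (fun x => Real.cos (inner ℝ x t)) (fun x => Real.cos (inner ℝ x t)),
    integral_prod_mul (fun x => Real.sin (inner ℝ x t)) (fun x => Real.sin (inner ℝ x t)),
    ← charFun_re, ← charFun_im, ← Complex.normSq_eq_norm_sq, Complex.normSq_apply]

variable [FiniteDimensional ℝ E]

/-- An inequality of Esseen type: a measure whose characteristic function is small near the origin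
gives little mass to balls. The proof tests the measure against `|ρ̂|²`, for `ρ` Lebesgue measure
on a small ball, which is positive definite and bounded below on the given ball. -/
theorem measureReal_closedBall_le_of_norm_charFun_le {κ : Measure E} [IsProbabilityMeasure κ]
    {η r : ℝ} (hη : 0 < η) (hr : η * r ≤ 1) {g : E → ℝ} (hg : Integrable g)
    (hg0 : ∀ t, 0 ≤ g t) (h : ∀ t, ‖t‖ ≤ 2 * η → ‖charFun κ t‖ ≤ g t) :
    κ.real (Metric.closedBall 0 r) ≤ 4 / volume.real (Metric.closedBall (0 : E) η) * ∫ t, g t := by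
  set B := Metric.closedBall (0 : E) η with hB
  have hBm : MeasurableSet B := Metric.isClosed_closedBall.measurableSet
  set ρ : Measure E := volume.restrict B with hρ
  have : IsFiniteMeasure ρ := isFiniteMeasure_restrict.2 (measure_closedBall_lt_top).ne
  set v := volume.real B with hv
  have vpos : 0 < v := by
    rw [hv, measureReal_def, ENNReal.toReal_pos_iff]
    exact ⟨Metric.measure_closedBall_pos _ _ hη, measure_closedBall_lt_top⟩
  set τ : Measure E := ρ ∗ ρ.map (fun x => (-1 : ℝ) • x) with hτ
  have h1 (x : E) : charFun τ x = ((‖charFun ρ x‖ ^ 2 : ℝ) : ℂ) := by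
    rw [hτ, charFun_conv, charFun_map_smul, neg_one_smul, charFun_neg, Complex.mul_conj,
      Complex.normSq_eq_norm_sq]
  have h2 (x : E) (hx : x ∈ Metric.closedBall (0 : E) r) : (v / 2) ^ 2 ≤ ‖charFun ρ x‖ ^ 2 := by
    have : v / 2 ≤ ‖charFun ρ x‖ := by
      refine le_trans ?_ (Complex.re_le_norm _)
      rw [charFun_re]
      have e : v / 2 = ∫ s in B, (1 / 2 : ℝ) := by
        rw [setIntegral_const, smul_eq_mul, ← hv]; ring
      rw [e]
      refine setIntegral_mono_on (integrable_const _) ((integrable_const (1 : ℝ)).mono'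
        (by fun_prop) (.of_forall fun x => Real.abs_cos_le_one _)) hBm fun s hs => ?_
      rw [mem_closedBall_zero_iff] at hx
      rw [hB, mem_closedBall_zero_iff] at hs
      have h3 : |inner ℝ s x| ≤ 1 := (abs_real_inner_le_norm s x).trans
        ((mul_le_mul hs hx (norm_nonneg _) hη.le).trans hr)
      have h4 := Real.one_sub_sq_div_two_le_cos (x := inner ℝ s x)
      have h5 : (inner ℝ s x) ^ 2 ≤ 1 := (sq_le_one_iff_abs_le_one _).2 h3
      linarith
    gcongr
  have hbd : Integrable (fun x => ‖charFun ρ x‖ ^ 2) κ := by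
    refine (integrable_const (ρ.real Set.univ ^ 2)).mono'
      (measurable_charFun.norm.pow_const 2).aestronglyMeasurable (.of_forall fun x => ?_)
    rw [Real.norm_of_nonneg (by positivity)]
    gcongr
    exact norm_charFun_le x
  have h3 : κ.real (Metric.closedBall 0 r) * (v / 2) ^ 2 ≤ ∫ x, ‖charFun ρ x‖ ^ 2 ∂κ := by
    rw [← smul_eq_mul, ← setIntegral_const]
    exact (setIntegral_mono_on (integrable_const _) hbd.integrableOn
      Metric.isClosed_closedBall.measurableSet h2).trans
        (setIntegral_le_integral hbd (.of_forall fun x => by positivity))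
  have h4 : ∫ x, ‖charFun ρ x‖ ^ 2 ∂κ ≤ ∫ t, ‖charFun κ t‖ ∂τ := by
    have : ((∫ x, ‖charFun ρ x‖ ^ 2 ∂κ : ℝ) : ℂ) = ∫ t, charFun κ t ∂τ := by
      rw [← integral_charFun_comm, ← integral_complex_ofReal]
      simp only [h1]
    rw [← Complex.norm_of_nonneg (integral_nonneg fun x => by positivity), this]
    exact norm_integral_le_integral_norm _
  have hint : Integrable (fun t => ‖charFun κ t‖) τ :=
    (integrable_const (1 : ℝ)).mono' measurable_charFun.norm.aestronglyMeasurable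
      (.of_forall fun x => by simpa using norm_charFun_le_one x)
  have h5 : ∫ t, ‖charFun κ t‖ ∂τ ≤ v * ∫ t, g t := by
    rw [hτ, integral_conv hint]
    have e : v * ∫ t, g t = ∫ s in B, ∫ t, g t := by rw [setIntegral_const, smul_eq_mul]
    rw [e]
    refine integral_mono_of_nonneg (.of_forall fun x => integral_nonneg fun _ => norm_nonneg _)
      (integrable_const _) ?_
    refine (ae_restrict_iff' hBm).2 (.of_forall fun s hs => ?_)
    simp only
    have hms : Measurable fun y => ‖charFun κ (s + y)‖ :=
      (measurable_charFun.comp (measurable_const_add s)).norm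
    rw [integral_map (by fun_prop) hms.aestronglyMeasurable]
    have hgs : Integrable (fun t => g (s - t)) := hg.comp_sub_left s
    calc ∫ t in B, ‖charFun κ (s + (-1 : ℝ) • t)‖ ≤ ∫ t in B, g (s - t) := by
          refine integral_mono_of_nonneg (.of_forall fun _ => norm_nonneg _) hgs.integrableOn ?_
          refine (ae_restrict_iff' hBm).2 (.of_forall fun t ht => ?_)
          simp only [neg_one_smul, ← sub_eq_add_neg]
          rw [hB, mem_closedBall_zero_iff] at hs ht
          exact h _ ((norm_sub_le _ _).trans (by linarith))
      _ ≤ ∫ t, g (s - t) := setIntegral_le_integral hgs (.of_forall fun t => hg0 _)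
      _ = ∫ t, g t := integral_sub_left_eq_self g volume s
  rw [div_mul_eq_mul_div, le_div_iff₀ vpos]
  nlinarith

end charFun

/-- The space `ℂ³` with its Euclidean structure, both as a complex and as a real inner product
space. -/
abbrev ComplexTriple := PiLp 2 (fun _ : Fin 3 => ℂ)

theorem real_inner_eq_re_inner_complex (x t : ComplexTriple) :
    inner ℝ x t = (inner ℂ x t).re := by
  simp [PiLp.inner_apply, Complex.inner]

theorem real_inner_neg_I_smul (x t : ComplexTriple) :
    inner ℝ x (-Complex.I • t) = (inner ℂ x t).im := by
  rw [real_inner_eq_re_inner_complex, inner_smul_right]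
  simp

theorem charFun_map_I_smul (ν : Measure ComplexTriple) (t : ComplexTriple) :
    charFun (ν.map fun x => Complex.I • x) t = charFun ν (-Complex.I • t) := by
  rw [charFun_apply, charFun_apply, integral_map (by fun_prop) (by fun_prop)]
  congr with x
  rw [real_inner_neg_I_smul, real_inner_eq_re_inner_complex, inner_smul_left]
  simp

theorem finrank_complexTriple : Module.finrank ℝ ComplexTriple = 6 := by
  rw [(WithLp.linearEquiv 2 ℝ (Fin 3 → ℂ)).finrank_eq, Module.finrank_pi_fintype]
  simp [Complex.finrank_real_complex]

/-- Anticoncentration for a law `ν` on `ℂ³`. The bound on `|φ(t) φ(-it)|` is a bound for the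
characteristic function of `V + i V'`, with `V` and `V'` independent of law `ν`; so `ν` itself may
be concentrated on a real subspace of dimension three. -/
theorem measureReal_closedBall_sq_le {ν : Measure ComplexTriple} [IsProbabilityMeasure ν]
    {η b : ℝ} (hη : 0 < η) (hη1 : η * 4 ≤ 1) (hb : 0 < b)
    (h : ∀ t, ‖t‖ ≤ 2 * η →
      ‖charFun ν t‖ * ‖charFun ν (-Complex.I • t)‖ ≤ Real.exp (-b * ‖t‖ ^ 2)) :
    ν.real (Metric.closedBall 0 2) ^ 2 ≤
      4 / volume.real (Metric.closedBall (0 : ComplexTriple) η) * (Real.pi / b) ^ 3 := by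
  have hm : Measurable fun x : ComplexTriple => Complex.I • x := by fun_prop
  have : IsProbabilityMeasure (ν.map fun x => Complex.I • x) :=
    Measure.isProbabilityMeasure_map hm.aemeasurable
  have hint := GaussianFourier.integral_rexp_neg_mul_sq_norm (V := ComplexTriple) hb
  have hgi : Integrable fun t : ComplexTriple => Real.exp (-b * ‖t‖ ^ 2) := by
    by_contra hc
    rw [integral_undef hc] at hint
    have : 0 < (Real.pi / b) ^ ((Module.finrank ℝ ComplexTriple : ℝ) / 2) := by positivity
    linarith
  have h1 := measureReal_closedBall_le_of_norm_charFun_le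
    (κ := ν ∗ ν.map fun x => Complex.I • x) hη hη1 hgi (fun t => by positivity) fun t ht => by
      rw [charFun_conv, charFun_map_I_smul, norm_mul]
      exact h t ht
  rw [hint, finrank_complexTriple, show ((6 : ℕ) : ℝ) / 2 = (3 : ℕ) by norm_num,
    Real.rpow_natCast] at h1
  refine le_trans ?_ h1
  have hball : (fun x : ComplexTriple => Complex.I • x) ⁻¹' Metric.closedBall 0 2 =
      Metric.closedBall 0 2 := by
    ext x
    simp [norm_smul]
  have hsub : Metric.closedBall (0 : ComplexTriple) 2 ×ˢ Metric.closedBall (0 : ComplexTriple) 2 ⊆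
      (fun p : ComplexTriple × ComplexTriple => p.1 + p.2) ⁻¹' Metric.closedBall 0 4 := by
    rintro ⟨x, y⟩ ⟨hx, hy⟩
    simp only [mem_closedBall_zero_iff, Set.mem_preimage] at *
    exact (norm_add_le _ _).trans (by linarith)
  rw [Measure.conv, map_measureReal_apply (by fun_prop) Metric.isClosed_closedBall.measurableSet]
  refine le_trans (le_of_eq ?_) (measureReal_mono hsub)
  rw [measureReal_prod_prod, map_measureReal_apply hm Metric.isClosed_closedBall.measurableSet,
    hball, sq]

/-! ### Nondegeneracy of the Cauchy kernel at three points -/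

/-- The values at three points `x 0, x 1, x 2` of the Cauchy kernel with pole `w`. -/
noncomputable def cauchyVec (x : Fin 3 → ℂ) (w : ℂ) : ComplexTriple :=
  WithLp.toLp 2 fun j => (x j - w)⁻¹

theorem measurable_cauchyVec (x : Fin 3 → ℂ) : Measurable (cauchyVec x) := by
  unfold cauchyVec
  fun_prop

theorem continuousAt_cauchyVec {x : Fin 3 → ℂ} {w : ℂ} (h : ∀ j, x j ≠ w) :
    ContinuousAt (cauchyVec x) w := by
  unfold cauchyVec
  refine (PiLp.continuous_toLp 2 _).continuousAt.comp (continuousAt_pi.2 fun j => ?_)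
  exact ContinuousAt.inv₀ (by fun_prop) (sub_ne_zero.2 (h j))

/-- A combination of three Cauchy kernels with distinct poles takes no value four times: after
clearing denominators it becomes a polynomial of degree at most three. -/
theorem eq_zero_of_sum_cauchy_eq {x : Fin 3 → ℂ} (hx : Function.Injective x) {w : Fin 4 → ℂ}
    (hw : Function.Injective w) (hxw : ∀ j i, x j ≠ w i) {a : Fin 3 → ℂ} {c : ℂ}
    (h : ∀ i, ∑ j, a j * (x j - w i)⁻¹ = c) : a = 0 := by
  set Q : ℂ[X] := ∑ j, C (a j) * ∏ l ∈ Finset.univ.erase j, (X - C (x l)) +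
    C c * ∏ l, (X - C (x l)) with hQ
  have hdeg : Q.natDegree < 4 := by
    refine Nat.lt_succ_of_le ((natDegree_add_le _ _).trans (max_le ?_ ?_))
    · refine natDegree_sum_le_of_forall_le _ _ fun j _ => (natDegree_C_mul_le _ _).trans ?_
      refine (natDegree_prod_le _ _).trans ?_
      simp
    · refine (natDegree_C_mul_le _ _).trans ((natDegree_prod_le _ _).trans ?_)
      simp
  have hroot : ∀ i, Q.eval (w i) = 0 := fun i => by
    have hne : ∀ l, w i - x l ≠ 0 := fun l => sub_ne_zero.2 (hxw l i).symm
    have e : ∀ j, a j * ∏ l ∈ Finset.univ.erase j, (w i - x l) =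
        -(a j * (x j - w i)⁻¹) * ∏ l, (w i - x l) := fun j => by
      rw [← Finset.mul_prod_erase Finset.univ (fun l => w i - x l) (Finset.mem_univ j),
        ← neg_sub (w i) (x j), inv_neg]
      field_simp [hne j]
    simp only [hQ, eval_add, eval_finsetSum, eval_mul, eval_C, eval_prod, eval_sub, eval_X, e]
    rw [← Finset.sum_mul, Finset.sum_neg_distrib, h i]
    ring
  have hQ0 : Q = 0 := eq_zero_of_natDegree_lt_card_of_eval_eq_zero Q hw hroot (by simpa using hdeg)
  funext j
  have h1 : Q.eval (x j) = 0 := by rw [hQ0, eval_zero]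
  have h2 : ∏ l, (x j - x l) = 0 := Finset.prod_eq_zero (Finset.mem_univ j) (sub_self _)
  simp only [hQ, eval_add, eval_finsetSum, eval_mul, eval_C, eval_prod, eval_sub, eval_X, h2,
    mul_zero, add_zero] at h1
  rw [Finset.sum_eq_single j] at h1
  · refine (mul_eq_zero.1 h1).resolve_right (Finset.prod_ne_zero_iff.2 fun l hl => ?_)
    exact sub_ne_zero.2 fun e => (Finset.mem_erase.1 hl).1 (hx e).symm
  · intro i _ hij
    rw [Finset.prod_eq_zero (Finset.mem_erase.2 ⟨hij.symm, Finset.mem_univ j⟩) (sub_self _),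
      mul_zero]
  · simp

theorem exists_le_norm_inner_cauchyVec_sub {x : Fin 3 → ℂ} (hx : Function.Injective x)
    {w : Fin 4 → ℂ} (hw : Function.Injective w) (hxw : ∀ j i, x j ≠ w i) :
    ∃ c : ℝ, 0 < c ∧ ∀ t : ComplexTriple, ∃ i,
      c * ‖t‖ ≤ ‖inner ℂ (cauchyVec x (w 0) - cauchyVec x (w i)) t‖ := by
  set L : ComplexTriple →ₗ[ℂ] (Fin 4 → ℂ) := LinearMap.pi fun i =>
    (innerₛₗ ℂ (cauchyVec x (w 0) - cauchyVec x (w i))) with hL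
  have hLi (t i) : L t i = inner ℂ (cauchyVec x (w 0) - cauchyVec x (w i)) t := rfl
  have hinj : LinearMap.ker L = ⊥ := by
    refine (Submodule.eq_bot_iff _).2 fun t ht => ?_
    have h1 : ∀ i, ∑ j, (starRingEnd ℂ) (t j) * (x j - w i)⁻¹ =
        ∑ j, (starRingEnd ℂ) (t j) * (x j - w 0)⁻¹ := fun i => by
      have h2 : inner ℂ (cauchyVec x (w 0) - cauchyVec x (w i)) t = 0 := by
        rw [← hLi, LinearMap.mem_ker.1 ht]; rfl
      rw [inner_sub_left, sub_eq_zero] at h2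
      have h3 := congrArg (starRingEnd ℂ) h2
      simp only [PiLp.inner_apply, map_sum, RCLike.inner_apply, map_mul, Complex.conj_conj,
        cauchyVec] at h3
      exact h3.symm
    have h4 := eq_zero_of_sum_cauchy_eq hx hw hxw h1
    ext j
    simpa using congrFun h4 j
  obtain ⟨K, hK0, hK⟩ := L.exists_antilipschitzWith hinj
  refine ⟨(K : ℝ)⁻¹, by positivity, fun t => ?_⟩
  have h1 : ‖t‖ ≤ K * ‖L t‖ := by simpa using hK.le_mul_dist t 0
  obtain ⟨i, hi⟩ : ∃ i, ‖L t‖ ≤ ‖L t i‖ := by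
    obtain ⟨i, -, hi⟩ := Finset.exists_max_image Finset.univ (fun i => ‖L t i‖) ⟨0, by simp⟩
    exact ⟨i, (pi_norm_le_iff_of_nonneg (norm_nonneg _)).2 fun k => hi k (by simp)⟩
  refine ⟨i, ?_⟩
  rw [inv_mul_le_iff₀ (by positivity), ← hLi]
  exact h1.trans (by gcongr)

/-- Suppose that a law on `ℂ³` charges bounded sets `U i` such that every direction `t` separates
`U 0` from one of the `U i`. Then its characteristic function `φ` has Gaussian decay near the
origin in the direction of `t` or of `-i t`, as expressed by the product `φ(t) φ(-it)`: the real and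
imaginary parts of the complex inner product with `t` cannot both be degenerate. -/
theorem exists_norm_charFun_mul_le {m : Measure ComplexTriple} [IsProbabilityMeasure m]
    {U : Fin 4 → Set ComplexTriple} {M c : ℝ} (hc : 0 < c) (hU : ∀ i, MeasurableSet (U i))
    (hm : ∀ i, 0 < m.real (U i)) (hM : ∀ i, ∀ x ∈ U i, ‖x‖ ≤ M)
    (h : ∀ t : ComplexTriple, ∃ i, ∀ x ∈ U 0, ∀ y ∈ U i, c * ‖t‖ ≤ ‖inner ℂ (x - y) t‖) :
    ∃ δ b : ℝ, 0 < δ ∧ 0 < b ∧ ∀ t, ‖t‖ ≤ δ →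
      ‖charFun m t‖ * ‖charFun m (-Complex.I • t)‖ ≤ Real.exp (-b * ‖t‖ ^ 2) := by
  obtain ⟨p, hp0, hp⟩ : ∃ p : ℝ, 0 < p ∧ ∀ i, p ≤ m.real (U i) := by
    obtain ⟨i, -, hi⟩ := Finset.exists_min_image Finset.univ (fun i => m.real (U i)) ⟨0, by simp⟩
    exact ⟨_, hm i, fun k => hi k (by simp)⟩
  have hpi := Real.pi_pos
  have hM0 : 0 ≤ M := by
    obtain ⟨x, hx⟩ : (U 0).Nonempty := nonempty_of_measureReal_ne_zero (hm 0).ne'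
    exact (norm_nonneg x).trans (hM 0 x hx)
  refine ⟨Real.pi / (2 * M + 1), p ^ 2 * c ^ 2 / Real.pi ^ 2, by positivity, by positivity,
    fun t ht => ?_⟩
  obtain ⟨i, hi⟩ := h t
  set k := 2 / Real.pi ^ 2 * (c * ‖t‖) ^ 2 with hk
  have hbound : ‖charFun m t‖ ^ 2 + ‖charFun m (-Complex.I • t)‖ ^ 2 ≤ 2 - k * p ^ 2 := by
    have hint (s : ComplexTriple) :
        Integrable (fun q => Real.cos (inner ℝ (q.1 - q.2) s)) (m.prod m) :=
      (integrable_const (1 : ℝ)).mono' (by fun_prop) (.of_forall fun x => Real.abs_cos_le_one _)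
    have hUm : MeasurableSet (U 0 ×ˢ U i) := (hU 0).prod (hU i)
    have hind : Integrable (fun q => 2 - (U 0 ×ˢ U i).indicator (fun _ => k) q) (m.prod m) :=
      (integrable_const _).sub ((integrable_const k).indicator hUm)
    rw [norm_charFun_sq, norm_charFun_sq, ← integral_add (hint _) (hint _)]
    calc _ ≤ ∫ q, (2 - (U 0 ×ˢ U i).indicator (fun _ => k) q) ∂(m.prod m) := by
          refine integral_mono ((hint _).add (hint _)) hind fun q => ?_
          simp only
          rw [real_inner_neg_I_smul, real_inner_eq_re_inner_complex]
          set H := inner ℂ (q.1 - q.2) t with hH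
          by_cases hq : q ∈ U 0 ×ˢ U i
          · rw [Set.indicator_of_mem hq]
            have hHπ : ‖H‖ ≤ Real.pi := by
              have h1 : ‖q.1 - q.2‖ ≤ 2 * M + 1 :=
                (norm_sub_le _ _).trans (by linarith [hM 0 _ hq.1, hM i _ hq.2])
              refine (norm_inner_le_norm _ _).trans ((mul_le_mul h1 ht (norm_nonneg _)
                (by positivity)).trans_eq ?_)
              field_simp
            have h1 := Real.cos_le_one_sub_mul_cos_sq ((Complex.abs_re_le_norm H).trans hHπ)
            have h2 := Real.cos_le_one_sub_mul_cos_sq ((Complex.abs_im_le_norm H).trans hHπ)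
            have h3 : (c * ‖t‖) ^ 2 ≤ H.re ^ 2 + H.im ^ 2 := by
              have h4 : H.re ^ 2 + H.im ^ 2 = ‖H‖ ^ 2 := by
                rw [← Complex.normSq_eq_norm_sq, Complex.normSq_apply]; ring
              rw [h4]
              exact pow_le_pow_left₀ (by positivity) (hi _ hq.1 _ hq.2) 2
            have h5 : k ≤ 2 / Real.pi ^ 2 * (H.re ^ 2 + H.im ^ 2) := by rw [hk]; gcongr
            linarith
          · rw [Set.indicator_of_notMem hq]
            linarith [Real.cos_le_one H.re, Real.cos_le_one H.im]
      _ = 2 - k * (m.real (U 0) * m.real (U i)) := by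
          rw [integral_sub (integrable_const _) ((integrable_const k).indicator hUm),
            integral_indicator hUm, setIntegral_const, measureReal_prod_prod]
          simp [mul_comm]
      _ ≤ 2 - k * p ^ 2 := by
          rw [sq p]
          have := mul_le_mul (hp 0) (hp i) hp0.le measureReal_nonneg
          have hk0 : 0 ≤ k := by positivity
          nlinarith
  have h1 : ‖charFun m t‖ * ‖charFun m (-Complex.I • t)‖ ≤ 1 - k * p ^ 2 / 2 := by
    nlinarith [sq_nonneg (‖charFun m t‖ - ‖charFun m (-Complex.I • t)‖)]
  refine h1.trans (le_trans (le_of_eq ?_) (Real.add_one_le_exp _))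
  rw [hk]
  field_simp
  ring

/-- If the support of `μ` is infinite, the law of the Cauchy kernel at three distinct points has
the Gaussian decay used for anticoncentration. -/
theorem exists_norm_charFun_cauchyVec_mul_le {μ : Measure ℂ} [IsProbabilityMeasure μ]
    (hμ : μ.support.Infinite) {x : Fin 3 → ℂ} (hx : Function.Injective x) :
    ∃ δ b : ℝ, 0 < δ ∧ 0 < b ∧ ∀ t, ‖t‖ ≤ δ →
      ‖charFun (μ.map (cauchyVec x)) t‖ * ‖charFun (μ.map (cauchyVec x)) (-Complex.I • t)‖ ≤
        Real.exp (-b * ‖t‖ ^ 2) := by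
  have hinf : (μ.support \ Set.range x).Infinite := hμ.sdiff (Set.finite_range x)
  obtain ⟨w, hw⟩ : ∃ w : Fin 4 → ℂ, Function.Injective w ∧ ∀ i, w i ∈ μ.support \ Set.range x := by
    let f := hinf.natEmbedding
    exact ⟨fun i => f i, fun i j hij => Fin.ext (f.injective (Subtype.ext hij)),
      fun i => (f i).2⟩
  obtain ⟨hwi, hws⟩ := hw
  have hxw : ∀ j i, x j ≠ w i := fun j i hji => (hws i).2 ⟨j, hji⟩
  obtain ⟨c, hc, hcw⟩ := exists_le_norm_inner_cauchyVec_sub hx hwi hxw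
  have hm := measurable_cauchyVec x
  have : IsProbabilityMeasure (μ.map (cauchyVec x)) :=
    Measure.isProbabilityMeasure_map hm.aemeasurable
  refine exists_norm_charFun_mul_le (U := fun i => Metric.closedBall (cauchyVec x (w i)) (c / 4))
    (M := (∑ i, ‖cauchyVec x (w i)‖) + c / 4) (c := c / 2) (by positivity)
    (fun i => Metric.isClosed_closedBall.measurableSet) (fun i => ?_) (fun i y hy => ?_)
    fun t => ?_
  · rw [map_measureReal_apply hm Metric.isClosed_closedBall.measurableSet, measureReal_def,
      ENNReal.toReal_pos_iff]
    refine ⟨(Measure.mem_support_iff_forall _).1 (hws i).1 _ ?_, measure_lt_top _ _⟩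
    exact (continuousAt_cauchyVec fun j => hxw j i).preimage_mem_nhds
      (Metric.closedBall_mem_nhds _ (by positivity))
  · rw [mem_closedBall_iff_norm] at hy
    have h1 := Finset.single_le_sum (f := fun i => ‖cauchyVec x (w i)‖)
      (fun i _ => norm_nonneg _) (Finset.mem_univ i)
    have h2 := norm_sub_norm_le y (cauchyVec x (w i))
    linarith
  · obtain ⟨i, hi⟩ := hcw t
    refine ⟨i, fun y hy y' hy' => ?_⟩
    rw [mem_closedBall_iff_norm] at hy hy'
    set d := cauchyVec x (w 0) - cauchyVec x (w i) with hd
    have h1 : ‖d - (y - y')‖ ≤ c / 2 := by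
      have : d - (y - y') = (y' - cauchyVec x (w i)) - (y - cauchyVec x (w 0)) := by
        rw [hd]; abel
      rw [this]
      exact (norm_sub_le _ _).trans (by linarith)
    have h2 : ‖inner ℂ d t‖ ≤ ‖inner ℂ (y - y') t‖ + ‖inner ℂ (d - (y - y')) t‖ := by
      rw [inner_sub_left d]
      exact norm_le_norm_add_norm_sub' _ _
    have h3 : ‖inner ℂ (d - (y - y')) t‖ ≤ c / 2 * ‖t‖ :=
      (norm_inner_le_norm _ _).trans (by gcongr)
    linarith

/-! ### Almost sure smallness of the set where the logarithmic derivative is small -/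

section Probability

variable {Ω : Type*} [MeasurableSpace Ω] {P : Measure Ω} {μ : Measure ℂ} {Z : ℕ → Ω → ℂ}

theorem charFun_map_sum_cauchyVec (hZ : ∀ k, Measurable (Z k)) (hindep : iIndepFun Z P)
    (hlaw : ∀ k, P.map (Z k) = μ) (x : Fin 3 → ℂ) (n : ℕ) (t : ComplexTriple) :
    charFun (P.map fun ω => ∑ k ∈ Finset.range n, cauchyVec x (Z k ω)) t =
      charFun (μ.map (cauchyVec x)) t ^ n := by
  have hm := measurable_cauchyVec x
  have hi : iIndepFun (fun k => cauchyVec x ∘ Z k) P := hindep.comp _ fun _ => hm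
  have h := (hi.restrict (Finset.range n)).charFun_map_fun_finsetSum_eq_prod
    (fun k _ => (hm.comp (hZ k)).aemeasurable)
  have hl (k : ℕ) : P.map (cauchyVec x ∘ Z k) = μ.map (cauchyVec x) := by
    rw [← Measure.map_map hm (hZ k), hlaw k]
  simp only [hl, Finset.prod_const, Finset.card_range, Function.comp_apply] at h
  rw [h, Pi.pow_apply]

/-- The strong law of large numbers for functions of the roots. -/
theorem ae_tendsto_average {F : Type*} [NormedAddCommGroup F] [NormedSpace ℝ F] [CompleteSpace F]
    [MeasurableSpace F] [BorelSpace F] (hZ : ∀ k, Measurable (Z k))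
    (hindep : iIndepFun Z P) (hlaw : ∀ k, P.map (Z k) = μ) {f : ℂ → F} (hf : Measurable f)
    (hfi : Integrable f μ) :
    ∀ᵐ ω ∂P, Tendsto (fun n : ℕ => (n : ℝ)⁻¹ • ∑ k ∈ Finset.range n, f (Z k ω)) atTop
      (𝓝 (∫ w, f w ∂μ)) := by
  have h := strong_law_ae (μ := P) (fun k => f ∘ Z k) ?_ ?_ ?_
  · have e : ∫ ω, (f ∘ Z 0) ω ∂P = ∫ w, f w ∂μ := by
      rw [← hlaw 0, integral_map (hZ 0).aemeasurable (by rw [hlaw 0]; exact hfi.1)]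
      rfl
    rwa [e] at h
  · exact Integrable.comp_measurable (by rwa [hlaw 0]) (hZ 0)
  · exact fun i j hij => (hindep.indepFun hij).comp hf hf
  · exact fun i => IdentDistrib.comp ⟨(hZ i).aemeasurable, (hZ 0).aemeasurable,
      by rw [hlaw, hlaw]⟩ hf

variable [IsProbabilityMeasure μ]

/-- The Cauchy transform of a finitely supported probability measure is a nonzero rational function
(it has a pole at every atom), so it vanishes at finitely many points only. -/
theorem finite_setOf_integral_inv_sub_eq_zero (hμ : μ.support.Finite) :
    {x : ℂ | x ∉ μ.support ∧ ∫ w, (x - w)⁻¹ ∂μ = 0}.Finite := by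
  classical
  set S := hμ.toFinset with hS
  have hSμ : ∀ᵐ w ∂μ, w ∈ (S : Set ℂ) := by
    have := Measure.support_mem_ae (μ := μ)
    filter_upwards [this] with w hw using by simpa [hS] using hw
  have hint (f : ℂ → ℂ) : ∫ w, f w ∂μ = ∑ a ∈ S, (μ.real {a} : ℂ) * f a := by
    have h1 : ∫ w, f w ∂μ = ∫ w in ⋃ a ∈ S, {a}, f w ∂μ := by
      have h2 : (⋃ a ∈ S, {a} : Set ℂ) = S := by ext; simp
      rw [h2, Measure.restrict_eq_self_of_ae_mem hSμ]
    rw [h1, integral_biUnion_finset S (fun a _ => measurableSet_singleton a)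
      (fun a _ b _ hab => Set.disjoint_singleton.2 hab)
      fun a _ => integrableOn_singleton (by simp)]
    simp only [integral_singleton, Complex.real_smul]
  set R : ℂ[X] := ∑ a ∈ S, C (μ.real {a} : ℂ) * ∏ b ∈ S.erase a, (X - C b) with hR
  obtain ⟨a₀, ha₀, hpos⟩ : ∃ a ∈ S, μ.real {a} ≠ 0 := by
    by_contra! h0
    have h1 := hint fun _ => 1
    rw [Finset.sum_eq_zero fun a ha => by simp [h0 a ha]] at h1
    simp at h1
  have hR0 : R ≠ 0 := fun h0 => by
    have h1 : R.eval a₀ = 0 := by rw [h0, eval_zero]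
    simp only [hR, eval_finsetSum, eval_mul, eval_C, eval_prod, eval_sub, eval_X] at h1
    rw [Finset.sum_eq_single_of_mem a₀ ha₀ fun a _ haa => ?_] at h1
    · refine (mul_ne_zero (by exact_mod_cast hpos) (Finset.prod_ne_zero_iff.2 fun b hb => ?_)) h1
      exact sub_ne_zero.2 (Finset.mem_erase.1 hb).1.symm
    · rw [Finset.prod_eq_zero (Finset.mem_erase.2 ⟨haa.symm, ha₀⟩) (sub_self _), mul_zero]
  refine (R.roots.toFinset.finite_toSet).subset fun x hx => ?_
  obtain ⟨hxS, hx0⟩ := hx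
  have hne : ∀ b ∈ S, x - b ≠ 0 := fun b hb => sub_ne_zero.2 fun e =>
    hxS (e ▸ by simpa [hS] using hb)
  have : R.eval x = 0 := by
    have e : ∀ a ∈ S, (μ.real {a} : ℂ) * ∏ b ∈ S.erase a, (x - b) =
        (μ.real {a} : ℂ) * (x - a)⁻¹ * ∏ b ∈ S, (x - b) := fun a ha => by
      rw [← Finset.mul_prod_erase S (fun b => x - b) ha]
      field_simp [hne a ha]
    simp only [hR, eval_finsetSum, eval_mul, eval_C, eval_prod, eval_sub, eval_X]
    rw [Finset.sum_congr rfl e, ← Finset.sum_mul, ← hint fun w => (x - w)⁻¹, hx0, zero_mul]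
  simpa [hR0] using this

theorem ae_eventually_notMem_smallSet_of_finite (hZ : ∀ k, Measurable (Z k))
    (hindep : iIndepFun Z P) (hlaw : ∀ k, P.map (Z k) = μ) (hμ : μ.support.Finite) :
    ∀ᵐ x : ℂ, ∀ᵐ ω ∂P, ∀ᶠ n in atTop, x ∉ smallSet (fun k => Z k ω) n := by
  have h1 : ∀ᵐ x : ℂ, x ∉ μ.support := compl_mem_ae_iff.2 (hμ.measure_zero _)
  have h2 : ∀ᵐ x : ℂ, x ∉ {x : ℂ | x ∉ μ.support ∧ ∫ w, (x - w)⁻¹ ∂μ = 0} :=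
    compl_mem_ae_iff.2 ((finite_setOf_integral_inv_sub_eq_zero hμ).measure_zero _)
  filter_upwards [h1, h2] with x hx1 hx2
  have hx3 : ∫ w, (x - w)⁻¹ ∂μ ≠ 0 := fun h => hx2 ⟨hx1, h⟩
  have hm : Measurable fun w : ℂ => (x - w)⁻¹ := by fun_prop
  -- a nonzero Bochner integral comes from an integrable function
  have hi : Integrable (fun w : ℂ => (x - w)⁻¹) μ := by
    by_contra h
    exact hx3 (integral_undef h)
  filter_upwards [ae_tendsto_average hZ hindep hlaw hm hi] with ω hω
  have h3 := hω.norm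
  have hlim : Tendsto (fun n : ℕ => (n : ℝ) * ‖(n : ℝ)⁻¹ • ∑ k ∈ Finset.range n, (x - Z k ω)⁻¹‖)
      atTop atTop := tendsto_natCast_atTop_atTop.atTop_mul_pos (norm_pos_iff.2 hx3) h3
  filter_upwards [hlim.eventually_gt_atTop 1, eventually_ne_atTop 0] with n hn hn0
  have hn' : (0 : ℝ) < n := by positivity
  rw [norm_smul, norm_inv, Real.norm_natCast, mul_inv_cancel_left₀ hn'.ne'] at hn
  exact not_le.2 hn

variable [IsProbabilityMeasure P]

/-- With infinite support, the probability that the logarithmic derivative is small at three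
given points simultaneously is `O(n ^ (-3 / 2))`, hence summable. -/
theorem exists_measureReal_smallSet_sq_le (hZ : ∀ k, Measurable (Z k)) (hindep : iIndepFun Z P)
    (hlaw : ∀ k, P.map (Z k) = μ) (hμ : μ.support.Infinite) {x : Fin 3 → ℂ}
    (hx : Function.Injective x) :
    ∃ C : ℝ, ∀ n : ℕ, n ≠ 0 →
      P.real {ω | ∀ j, x j ∈ smallSet (fun k => Z k ω) n} ^ 2 ≤ C * ((n : ℝ)⁻¹) ^ 3 := by
  obtain ⟨δ, b, hδ, hb, h⟩ := exists_norm_charFun_cauchyVec_mul_le hμ hx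
  have hm := measurable_cauchyVec x
  set η := min (δ / 2) (1 / 4) with hη
  have hη0 : 0 < η := by positivity
  refine ⟨4 / volume.real (Metric.closedBall (0 : ComplexTriple) η) * (Real.pi / b) ^ 3,
    fun n hn => ?_⟩
  have hn' : (0 : ℝ) < n := by positivity
  have hVm : Measurable fun ω => ∑ k ∈ Finset.range n, cauchyVec x (Z k ω) :=
    Finset.measurable_sum _ fun k _ => hm.comp (hZ k)
  set ν := P.map fun ω => ∑ k ∈ Finset.range n, cauchyVec x (Z k ω) with hν
  have : IsProbabilityMeasure ν := Measure.isProbabilityMeasure_map hVm.aemeasurable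
  have key := measureReal_closedBall_sq_le (ν := ν) (η := η) (b := n * b) hη0
    (by linarith [min_le_right (δ / 2) (1 / 4)]) (by positivity) fun t ht => by
      rw [hν, charFun_map_sum_cauchyVec hZ hindep hlaw, charFun_map_sum_cauchyVec hZ hindep hlaw,
        norm_pow, norm_pow, ← mul_pow]
      refine (pow_le_pow_left₀ (by positivity)
        (h t (ht.trans (by linarith [min_le_left (δ / 2) (1 / 4)]))) n).trans_eq ?_
      rw [← Real.exp_nat_mul]
      ring_nf
  rw [hν, map_measureReal_apply hVm Metric.isClosed_closedBall.measurableSet] at key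
  have hsub : {ω | ∀ j, x j ∈ smallSet (fun k => Z k ω) n} ⊆
      (fun ω => ∑ k ∈ Finset.range n, cauchyVec x (Z k ω)) ⁻¹' Metric.closedBall 0 2 := by
    intro ω hω
    rw [Set.mem_preimage, mem_closedBall_zero_iff, EuclideanSpace.norm_eq]
    refine (Real.sqrt_le_left (by norm_num)).2 ?_
    have hj (j : Fin 3) : ‖(∑ k ∈ Finset.range n, cauchyVec x (Z k ω)) j‖ ^ 2 ≤ 1 := by
      have h1 : (∑ k ∈ Finset.range n, cauchyVec x (Z k ω)) j =
          cauchySum (fun k => Z k ω) n (x j) := by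
        simp [cauchySum, cauchyVec]
      rw [h1]
      exact pow_le_one₀ (norm_nonneg _) (hω j)
    refine (Finset.sum_le_sum fun j _ => hj j).trans ?_
    norm_num
  calc _ ≤ _ := pow_le_pow_left₀ measureReal_nonneg (measureReal_mono hsub) 2
    _ ≤ _ := key
    _ = _ := by field_simp

theorem ae_eventually_exists_notMem_smallSet_of_infinite (hZ : ∀ k, Measurable (Z k))
    (hindep : iIndepFun Z P) (hlaw : ∀ k, P.map (Z k) = μ) (hμ : μ.support.Infinite)
    {x : Fin 3 → ℂ} (hx : Function.Injective x) :
    ∀ᵐ ω ∂P, ∀ᶠ n in atTop, ∃ j, x j ∉ smallSet (fun k => Z k ω) n := by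
  obtain ⟨C, hC⟩ := exists_measureReal_smallSet_sq_le hZ hindep hlaw hμ hx
  have hC0 : 0 ≤ C := by simpa using (sq_nonneg _).trans (hC 1 one_ne_zero)
  set A : ℕ → Set Ω := fun n => {ω | ∀ j, x j ∈ smallSet (fun k => Z k ω) n} with hA
  have hle : ∀ n : ℕ, P.real (A (n + 1)) ≤ √C * (1 / ((n + 1 : ℕ) : ℝ) ^ (3 / 2 : ℝ)) := by
    intro n
    refine abs_le_of_sq_le_sq' ?_ (by positivity) |>.2
    refine (hC (n + 1) n.succ_ne_zero).trans_eq ?_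
    rw [mul_pow, Real.sq_sqrt hC0, div_pow, ← Real.rpow_natCast (_ ^ (3 / 2 : ℝ)),
      ← Real.rpow_mul (by positivity), inv_pow, one_pow, one_div,
      show (3 / 2 : ℝ) * (2 : ℕ) = (3 : ℕ) by norm_num, Real.rpow_natCast]
  have hsum : Summable fun n : ℕ => √C * (1 / ((n + 1 : ℕ) : ℝ) ^ (3 / 2 : ℝ)) :=
    (((Real.summable_one_div_nat_rpow (p := 3 / 2)).2 (by norm_num)).comp_injective
      (add_left_injective 1)).mul_left _
  have hfin : ∑' n, P (A (n + 1)) ≠ ∞ := by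
    have h1 : ∀ n, P (A (n + 1)) ≤
        ENNReal.ofReal (√C * (1 / ((n + 1 : ℕ) : ℝ) ^ (3 / 2 : ℝ))) := fun n => by
      rw [← ofReal_measureReal (measure_ne_top _ _)]
      exact ENNReal.ofReal_le_ofReal (hle n)
    exact ne_top_of_le_ne_top hsum.tsum_ofReal_ne_top (ENNReal.tsum_le_tsum h1)
  filter_upwards [ae_eventually_notMem hfin] with ω hω
  rw [← map_add_atTop_eq_nat 1, eventually_map]
  filter_upwards [hω] with n hn
  simpa [hA] using hn

theorem ae_injective_fin : ∀ᵐ x : Fin 3 → ℂ, Function.Injective x := by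
  have h : ∀ i j : Fin 3, i ≠ j → ∀ᵐ x : Fin 3 → ℂ, x i ≠ x j := fun i j hij => by
    set s : Submodule ℝ (Fin 3 → ℂ) := LinearMap.ker
      ((LinearMap.proj i : (Fin 3 → ℂ) →ₗ[ℝ] ℂ) - LinearMap.proj j) with hs
    have hst : s ≠ ⊤ := fun e => by
      have : Pi.single i (1 : ℂ) ∈ s := e ▸ Submodule.mem_top
      simp [hs, hij.symm] at this
    filter_upwards [compl_mem_ae_iff.2 (Measure.addHaar_submodule volume s hst)] with x hx e
    exact hx (by simp [hs, e])
  have h' : ∀ᵐ x : Fin 3 → ℂ, ∀ i j : Fin 3, i ≠ j → x i ≠ x j := by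
    simp only [ae_all_iff]
    exact h
  filter_upwards [h'] with x hx i j hij
  by_contra hne
  exact hx i j hne hij

theorem ae_ae_eventually_exists_notMem_smallSet (hZ : ∀ k, Measurable (Z k))
    (hindep : iIndepFun Z P) (hlaw : ∀ k, P.map (Z k) = μ) :
    ∀ᵐ ω ∂P, ∀ᵐ x : Fin 3 → ℂ, ∀ᶠ n in atTop, ∃ j, x j ∉ smallSet (fun k => Z k ω) n := by
  rw [← Measure.ae_ae_comm]
  · by_cases hμ : μ.support.Finite
    · have h := (Measure.quasiMeasurePreserving_eval (fun _ : Fin 3 => (volume : Measure ℂ)) 0).ae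
        (ae_eventually_notMem_smallSet_of_finite hZ hindep hlaw hμ)
      filter_upwards [h] with x hx
      filter_upwards [hx] with ω hω
      filter_upwards [hω] with n hn using ⟨0, hn⟩
    · filter_upwards [ae_injective_fin] with x hx
      exact ae_eventually_exists_notMem_smallSet_of_infinite hZ hindep hlaw hμ hx
  · have : {p : (Fin 3 → ℂ) × Ω | ∀ᶠ n in atTop, ∃ j, p.1 j ∉ smallSet (fun k => Z k p.2) n} =
        liminf (fun n => ⋃ j, {p : (Fin 3 → ℂ) × Ω | p.1 j ∉ smallSet (fun k => Z k p.2) n})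
          atTop := by
      ext p
      simp [mem_liminf_iff_eventually_mem]
    rw [this]
    refine MeasurableSet.measurableSet_liminf fun n => MeasurableSet.iUnion fun j => ?_
    refine MeasurableSet.compl (s := {p : (Fin 3 → ℂ) × Ω | p.1 j ∈ smallSet (fun k => Z k p.2) n})
      ?_
    have hm : Measurable fun p : (Fin 3 → ℂ) × Ω => cauchySum (fun k => Z k p.2) n (p.1 j) := by
      unfold cauchySum
      fun_prop
    exact hm.norm measurableSet_Iic

/-- A set whose cube avoids almost every triple eventually has vanishing measure. -/
theorem tendsto_volume_inter_smallSet {z : ℕ → ℂ}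
    (h : ∀ᵐ x : Fin 3 → ℂ, ∀ᶠ n in atTop, ∃ j, x j ∉ smallSet z n) (R : ℝ) :
    Tendsto (fun n => volume (Metric.closedBall 0 R ∩ smallSet z n)) atTop (𝓝 0) := by
  have hD : MeasurableSet (Metric.closedBall (0 : ℂ) R) := Metric.isClosed_closedBall.measurableSet
  have hcube := tendsto_measure_of_ae_tendsto_indicator (μ := (volume : Measure (Fin 3 → ℂ)))
    atTop (A := ∅) (As := fun n => Set.univ.pi fun _ => Metric.closedBall 0 R ∩ smallSet z n)
    (B := Set.univ.pi fun _ => Metric.closedBall 0 R) MeasurableSet.empty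
    (fun n => MeasurableSet.univ_pi fun _ => hD.inter (measurableSet_smallSet z n))
    (MeasurableSet.univ_pi fun _ => hD)
    (by rw [volume_pi_pi]; exact ENNReal.prod_ne_top fun _ _ => measure_closedBall_lt_top.ne)
    (.of_forall fun n => Set.pi_mono fun _ _ => Set.inter_subset_left) (by
      filter_upwards [h] with x hx
      filter_upwards [hx] with n hn
      simp only [Set.mem_empty_iff_false, iff_false, Set.mem_univ_pi, not_forall]
      obtain ⟨j, hj⟩ := hn
      exact ⟨j, fun h => hj h.2⟩)
  simp only [volume_pi_pi, Finset.prod_const, Finset.card_univ, Fintype.card_fin,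
    measure_empty] at hcube
  have h3 := (ENNReal.continuous_rpow_const (y := 1 / 3)).tendsto 0 |>.comp hcube
  rw [ENNReal.zero_rpow_of_pos (by norm_num)] at h3
  refine h3.congr fun n => ?_
  simp only [Function.comp_apply]
  rw [← ENNReal.rpow_natCast, ← ENNReal.rpow_mul]
  norm_num

end Probability

/-! ### Weak convergence of the empirical measures of the roots -/

/-- The empirical measure of `z 0, …, z n`. -/
noncomputable def empiricalMeasure (z : ℕ → ℂ) (n : ℕ) : Measure ℂ :=
  ((n + 1 : ℕ) : ℝ≥0∞)⁻¹ • (((Multiset.range (n + 1)).map z).map Measure.dirac).sum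

instance isProbabilityMeasure_empiricalMeasure (z : ℕ → ℂ) (n : ℕ) :
    IsProbabilityMeasure (empiricalMeasure z n) := by
  constructor
  rw [empiricalMeasure, Measure.smul_apply, sum_dirac_univ, smul_eq_mul, Multiset.card_map,
    Multiset.card_range]
  exact ENNReal.inv_mul_cancel (by simp) (ENNReal.natCast_ne_top _)

theorem integral_empiricalMeasure (z : ℕ → ℂ) (n : ℕ) (φ : ℂ → ℝ) :
    ∫ x, φ x ∂(empiricalMeasure z n) =
      ((n + 1 : ℕ) : ℝ)⁻¹ * ∑ k ∈ Finset.range (n + 1), φ (z k) := by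
  rw [empiricalMeasure, integral_smul_measure, (integrable_and_integral_sum_dirac _).2,
    smul_eq_mul, ENNReal.toReal_inv, ENNReal.toReal_natCast, Multiset.map_map]
  rfl

/-- In a second countable space a compact subset of an open set is covered by finitely many basic
open subsets of it. -/
theorem exists_finite_countableBasis_between {K G : Set ℂ} (hK : IsCompact K) (hG : IsOpen G)
    (hKG : K ⊆ G) :
    ∃ s : Set (Set ℂ), s.Finite ∧ s ⊆ TopologicalSpace.countableBasis ℂ ∧
      K ⊆ ⋃₀ s ∧ ⋃₀ s ⊆ G := by
  have hB := TopologicalSpace.isBasis_countableBasis ℂ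
  obtain ⟨S, hSB, rfl⟩ := hB.open_eq_sUnion hG
  obtain ⟨s, hsS, hsf, hKs⟩ := hK.elim_finite_subcover_image (b := S) (c := id)
    (fun t ht => hB.isOpen (hSB ht)) (by simpa [Set.sUnion_eq_biUnion] using hKG)
  exact ⟨s, hsf, hsS.trans hSB, by rwa [Set.sUnion_eq_biUnion], Set.sUnion_subset_sUnion hsS⟩

/-- Almost surely, the empirical measures of an independent sample converge weakly to its law. -/
theorem ae_tendsto_average_of_hasCompactSupport {Ω : Type*} [MeasurableSpace Ω] {P : Measure Ω}
    {μ : ProbabilityMeasure ℂ} {Z : ℕ → Ω → ℂ} (hZ : ∀ k, Measurable (Z k))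
    (hindep : iIndepFun Z P) (hlaw : ∀ k, P.map (Z k) = μ) :
    ∀ᵐ ω ∂P, ∀ φ : ℂ → ℝ, Continuous φ → HasCompactSupport φ →
      Tendsto (fun n : ℕ => (n : ℝ)⁻¹ * ∑ k ∈ Finset.range n, φ (Z k ω)) atTop
        (𝓝 (∫ x, φ x ∂(μ : Measure ℂ))) := by
  set 𝒮 : Set (Set (Set ℂ)) := {s | s.Finite ∧ s ⊆ TopologicalSpace.countableBasis ℂ} with h𝒮
  have hcount : 𝒮.Countable :=
    Set.countable_ofPred_finite_subset (TopologicalSpace.countable_countableBasis ℂ)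
  have hopen : ∀ s ∈ 𝒮, IsOpen (⋃₀ s) := fun s hs =>
    isOpen_sUnion fun t ht => TopologicalSpace.isOpen_of_mem_countableBasis (hs.2 ht)
  have hae : ∀ᵐ ω ∂P, ∀ s ∈ 𝒮, Tendsto (fun n : ℕ => (n : ℝ)⁻¹ •
      ∑ k ∈ Finset.range n, (⋃₀ s).indicator (fun _ => (1 : ℝ)) (Z k ω)) atTop
        (𝓝 (∫ w, (⋃₀ s).indicator (fun _ => (1 : ℝ)) w ∂(μ : Measure ℂ))) := by
    rw [ae_ball_iff hcount]
    intro s hs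
    have hm := (hopen s hs).measurableSet
    exact ae_tendsto_average hZ hindep hlaw (measurable_const.indicator hm)
      ((integrable_const 1).indicator hm)
  filter_upwards [hae] with ω hω φ hφ hc
  set z : ℕ → ℂ := fun k => Z k ω
  have hind (ν : Measure ℂ) {s} (hs : s ∈ 𝒮) :
      ∫ w, (⋃₀ s).indicator (fun _ => (1 : ℝ)) w ∂ν = ν.real (⋃₀ s) := by
    rw [integral_indicator (hopen s hs).measurableSet, setIntegral_const, smul_eq_mul, mul_one]
  have hlim : ∀ s ∈ 𝒮, Tendsto (fun n => empiricalMeasure z n (⋃₀ s)) atTop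
      (𝓝 ((μ : Measure ℂ) (⋃₀ s))) := fun s hs => by
    rw [← ENNReal.tendsto_toReal_iff (fun _ => measure_ne_top _ _) (measure_ne_top _ _)]
    have h := (hω s hs).comp (tendsto_add_atTop_nat 1)
    rw [hind _ hs] at h
    refine h.congr fun n => ?_
    rw [← measureReal_def, ← hind _ hs, integral_empiricalMeasure]
    rfl
  set ν : ℕ → ProbabilityMeasure ℂ := fun n => ⟨empiricalMeasure z n, inferInstance⟩
  have hweak : Tendsto ν atTop (𝓝 μ) := by
    refine tendsto_of_forall_isOpen_le_liminf' fun G hG => le_of_forall_lt fun r hr => ?_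
    obtain ⟨K, hKG, hK, hrK⟩ := hG.exists_lt_isCompact hr
    obtain ⟨s, hsf, hsb, hKs, hsG⟩ := exists_finite_countableBasis_between hK hG hKG
    refine (hrK.trans_le (measure_mono hKs)).trans_le ?_
    rw [← (hlim s ⟨hsf, hsb⟩).liminf_eq]
    exact liminf_le_liminf (.of_forall fun n => measure_mono hsG)
  obtain ⟨M, hM⟩ := hφ.bounded_above_of_compact_support hc
  have h := ProbabilityMeasure.tendsto_iff_forall_integral_tendsto.1 hweak
    (BoundedContinuousFunction.ofNormedAddCommGroup φ hφ M hM)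
  rw [← tendsto_add_atTop_iff_nat 1]
  refine h.congr fun n => ?_
  exact integral_empiricalMeasure z n φ

theorem theorem1p2 {Ω : Type*} [MeasurableSpace Ω] (P : Measure Ω) [IsProbabilityMeasure P]
    (μ : ProbabilityMeasure ℂ) (Z : ℕ → Ω → ℂ)
    (hindep : iIndepFun Z P) (hlaw : ∀ k, HasLaw (Z k) (μ : Measure ℂ) P) :
    ∀ᵐ ω ∂P, Tendsto
      (fun n : ℕ => criticalProbabilityMeasure (fun k => Z k ω) (n + 2) (Nat.le_add_left 2 n))
      atTop (𝓝 μ) := by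
  -- the hypotheses only provide almost everywhere measurability: pass to measurable versions
  set Y : ℕ → Ω → ℂ := fun k => (hlaw k).aemeasurable.mk (Z k)
  have hYm : ∀ k, Measurable (Y k) := fun k => (hlaw k).aemeasurable.measurable_mk
  have hZY : ∀ k, Z k =ᵐ[P] Y k := fun k => (hlaw k).aemeasurable.ae_eq_mk
  have hYindep : iIndepFun Y P := hindep.congr hZY
  have hYlaw : ∀ k, P.map (Y k) = μ := fun k => by
    rw [← Measure.map_congr (hZY k), (hlaw k).map_eq]
  filter_upwards [ae_all_iff.2 hZY, ae_ae_eventually_exists_notMem_smallSet hYm hYindep hYlaw,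
    ae_tendsto_average_of_hasCompactSupport hYm hYindep hYlaw] with ω h1 h2 h3
  rw [show (fun k => Z k ω) = fun k => Y k ω from funext h1]
  exact tendsto_criticalProbabilityMeasure (tendsto_volume_inter_smallSet h2) h3
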